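/- Let $L$ be a perfect field of characteristic $p>0$, let $N\geq 2$, and let $h\in R=L[x_0,\ldots,x_N]$ be a homogeneous polynomial of degree $d\geq N+1$. For an ideal $J\subseteq R$ and $e\geq 1$ let $J^{[p^e]}$ be the ideal generated by the $p^e$-th powers of the elements of $J$; for an ideal $\mathfrak b\subseteq R$ let $\mathfrak b^{[1/p^e]}$ be the smallest ideal $J$ with $\mathfrak b\subseteq J^{[p^e]}$. For $\lambda\in\mathbf R_{\geq 0}$ the ideals $(h^{\lceil\lambda p^e\rceil})^{[1/p^e]}$ $(e\geq 1)$ form an increasing chain, whose stable value is the test ideal $\tau(\mathbf A^{N+1}_L,h^{\lambda})$. Let $D=V(h)=\operatorname{Proj}(R/(h))\subset\mathbf P^N_L$ be the hypersurface defined by $h$. The Frobenius action on $H^{N-1}(D,\mathcal O_D)$ is the additive map induced on sheaf cohomology by the endomorphism $s\mapsto s^p$ of the sheaf of abelian groups $\mathcal O_D$. If $$(x_0,\ldots,x_N)^{d-N-1}\subseteq\tau\bigl(\mathbf A_L^{N+1},h^{1-\frac1p}\bigr),$$ then the Frobenius action on $H^{N-1}(D,\mathcal O_D)$ is bijective. 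-/

import Mathlib

universe u

open CategoryTheory AlgebraicGeometry

/-! ### Frobenius powers, Frobenius roots, test ideals -/

section TestIdeals

variable {R : Type*} [CommRing R]

/-- The Frobenius power `J^[q]`: the ideal generated by the `q`-th powers of the elements of `J`
(used for `q = p ^ e` in characteristic `p`). -/
def Ideal.frobPow (J : Ideal R) (q : ℕ) : Ideal R :=
  Ideal.span ((fun a : R => a ^ q) '' (J : Set R))

/-- The ideal `𝔟^[1/q]`: the smallest ideal `J` such that `𝔟 ⊆ J^[q]`, obtained as the intersection
of all such `J` (over a regular ring of finite type over a perfect field, that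
intersection is itself such a `J`). -/
def Ideal.frobRoot (b : Ideal R) (q : ℕ) : Ideal R :=
  sInf {J : Ideal R | b ≤ J.frobPow q}

/-- The test ideal `τ(𝔞^lam)`: the stable value of the increasing chain of ideals
`(𝔞^⌈lam p^e⌉)^[1/p^e]`, `e ≥ 1`, in a Noetherian ring that is regular and of finite type over a
perfect field of characteristic `p`; the stable value is the supremum of the chain. -/
noncomputable def Ideal.testIdeal (p : ℕ) (a : Ideal R) (lam : ℝ) : Ideal R :=
  ⨆ (e : ℕ) (_ : 1 ≤ e), (a ^ ⌈lam * (p : ℝ) ^ e⌉₊).frobRoot (p ^ e)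

end TestIdeals

/-! ### The Frobenius action on the cohomology of the structure sheaf -/

namespace AlgebraicGeometry.Scheme

/-- The structure sheaf of a scheme as a sheaf of abelian groups on the underlying space. -/
noncomputable def structureAbSheaf (X : Scheme.{u}) :
    Sheaf (Opens.grothendieckTopology X) AddCommGrpCat.{u} :=
  (sheafCompose (Opens.grothendieckTopology X)
    (forget₂ CommRingCat.{u} RingCat.{u} ⋙ forget₂ RingCat.{u} AddCommGrpCat.{u})).obj X.sheaf

/-- The sheaf cohomology group `H^n(X, 𝒪_X)`. -/
abbrev structureCohomology (X : Scheme.{u}) (n : ℕ) : Type u :=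
  Sheaf.H.{u} X.structureAbSheaf n

/-- The additive map `s ↦ s ^ p` of a commutative ring in which `p = 0`. -/
def powAddHom {A : Type*} [CommRing A] (p : ℕ) [hp : Fact p.Prime] (hA : (p : A) = 0) :
    A →+ A where
  toFun s := s ^ p
  map_zero' := zero_pow hp.out.ne_zero
  map_add' x y := by
    obtain ⟨r, hr⟩ := exists_add_pow_prime_eq hp.out x y
    rw [hr, hA]
    ring

/-- The scheme `X` is of characteristic `p`: one has `p = 0` in `Γ(X, 𝒪_X)`. -/
def IsCharP (X : Scheme.{u}) (p : ℕ) : Prop := (p : Γ(X, ⊤)) = 0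

lemma IsCharP.cast_eq_zero {X : Scheme.{u}} {p : ℕ} (h : X.IsCharP p) (U : X.Opens) :
    (p : Γ(X, U)) = 0 := by
  have := congrArg (X.presheaf.map (homOfLE le_top : U ⟶ ⊤).op).hom h
  simpa using this

/-- The absolute Frobenius morphism of a scheme of characteristic `p` is the identity on the
underlying space and `s ↦ s ^ p` on sections of the structure sheaf. This is its comorphism
`𝒪_X ⟶ F_* 𝒪_X = 𝒪_X`, as a morphism of sheaves of abelian groups. -/
noncomputable def frobeniusAbSheaf (X : Scheme.{u}) (p : ℕ) [Fact p.Prime] (h : X.IsCharP p) :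
    X.structureAbSheaf ⟶ X.structureAbSheaf where
  hom :=
    { app := fun U => AddCommGrpCat.ofHom
        (powAddHom (A := Γ(X, U.unop)) p (h.cast_eq_zero U.unop))
      naturality := fun U V f => by
        ext s
        exact (map_pow (X.presheaf.map f).hom (show Γ(X, U.unop) from s) p).symm }

/-- The Frobenius action on `H^n(X, 𝒪_X)`, for a scheme `X` of characteristic `p`. -/
noncomputable def frobeniusAction (X : Scheme.{u}) (p : ℕ) [Fact p.Prime] (h : X.IsCharP p)
    (n : ℕ) : X.structureCohomology n →+ X.structureCohomology n :=
  Sheaf.H.map (X.frobeniusAbSheaf p h) n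

end AlgebraicGeometry.Scheme

/-! ### The hypersurface `V(h) ⊆ ℙ^N` -/

namespace ProjHypersurface

open MvPolynomial

attribute [local instance] MvPolynomial.gradedAlgebra

variable {L : Type u} [Field L] {N : ℕ}

/-- The homogeneous coordinate ring `L[x_0, …, x_N] / (h)`. -/
abbrev CoordRing (h : MvPolynomial (Fin (N + 1)) L) : Type u :=
  MvPolynomial (Fin (N + 1)) L ⧸ Ideal.span {h}

/-- The degree `n` part of `L[x_0, …, x_N] / (h)`: the classes of the forms of degree `n`. -/
noncomputable def grading (h : MvPolynomial (Fin (N + 1)) L) (n : ℕ) : Submodule L (CoordRing h) :=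
  (homogeneousSubmodule (Fin (N + 1)) L n).map
    (Ideal.Quotient.mkₐ L (Ideal.span {h})).toLinearMap

/-- Taking the class modulo `h` of a form of degree `n`. -/
noncomputable def gradingMk (h : MvPolynomial (Fin (N + 1)) L) (n : ℕ) :
    homogeneousSubmodule (Fin (N + 1)) L n →ₗ[L] grading h n :=
  ((Ideal.Quotient.mkₐ L (Ideal.span {h})).toLinearMap.restrict
    (fun _ hx => Submodule.mem_map_of_mem hx))

/-- The map sending a polynomial to the classes modulo `h` of its homogeneous components. -/
noncomputable def decomposePoly (h : MvPolynomial (Fin (N + 1)) L) :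
    MvPolynomial (Fin (N + 1)) L →ₗ[L] DirectSum ℕ (fun n => grading h n) :=
  (DFinsupp.mapRange.linearMap (gradingMk h)) ∘ₗ
    (DirectSum.decomposeLinearEquiv (homogeneousSubmodule (Fin (N + 1)) L)).toLinearMap

lemma coe_decomposePoly (h f : MvPolynomial (Fin (N + 1)) L) (n : ℕ) :
    ((decomposePoly h f n : grading h n) : CoordRing h) =
      Ideal.Quotient.mk _ (homogeneousComponent n f) := by
  rw [← decomposition.decompose'_apply]
  rfl

lemma decomposePoly_coe (h : MvPolynomial (Fin (N + 1)) L) {n : ℕ}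
    (f : homogeneousSubmodule (Fin (N + 1)) L n) :
    decomposePoly h f = DirectSum.lof L ℕ (fun n => grading h n) n (gradingMk h n f) := by
  have : DirectSum.decomposeLinearEquiv (homogeneousSubmodule (Fin (N + 1)) L)
      (f : MvPolynomial (Fin (N + 1)) L) = DFinsupp.single n f :=
    DirectSum.decompose_coe (homogeneousSubmodule (Fin (N + 1)) L) f
  change DFinsupp.mapRange.linearMap (gradingMk h) (DirectSum.decomposeLinearEquiv _ _) = _
  rw [this]
  exact DFinsupp.mapRange_single (hf := fun i => map_zero (gradingMk h i))

lemma decomposePoly_eq_zero {h : MvPolynomial (Fin (N + 1)) L} {d : ℕ} (hh : h.IsHomogeneous d)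
    (f : MvPolynomial (Fin (N + 1)) L) (hf : f ∈ Ideal.span {h}) : decomposePoly h f = 0 := by
  have hI : (Ideal.span {h}).IsHomogeneous (homogeneousSubmodule (Fin (N + 1)) L) :=
    Ideal.homogeneous_span _ _ (by rintro x rfl; exact ⟨d, hh⟩)
  refine DFinsupp.ext fun n => Subtype.ext ?_
  rw [coe_decomposePoly]
  exact Ideal.Quotient.eq_zero_iff_mem.2 ((mem_iff_homogeneousComponent_mem hI f).1 hf n)

/-- The decomposition of `L[x_0, …, x_N] / (h)` into graded pieces, for `h` homogeneous. -/
noncomputable def decomposeQuot {h : MvPolynomial (Fin (N + 1)) L} {d : ℕ}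
    (hh : h.IsHomogeneous d) : CoordRing h →+ DirectSum ℕ (fun n => grading h n) :=
  QuotientAddGroup.lift (Submodule.toAddSubgroup (Ideal.span {h}))
    (decomposePoly h).toAddMonoidHom (fun f hf => decomposePoly_eq_zero hh f hf)

/-- For `h` homogeneous, `L[x_0, …, x_N] / (h)` is a graded `L`-algebra. -/
@[reducible] noncomputable def gradedAlgebra {h : MvPolynomial (Fin (N + 1)) L} {d : ℕ}
    (hh : h.IsHomogeneous d) : GradedAlgebra (grading h) where
  one_mem := ⟨1, isHomogeneous_one _ _, map_one (Ideal.Quotient.mkₐ L _)⟩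
  mul_mem := by
    rintro i j _ _ ⟨f, hf, rfl⟩ ⟨g, hg, rfl⟩
    exact ⟨f * g, IsHomogeneous.mul hf hg, map_mul (Ideal.Quotient.mkₐ L _) f g⟩
  toDecomposition := DirectSum.Decomposition.ofAddHom (grading h) (decomposeQuot hh)
    (by
      refine AddMonoidHom.ext fun x => ?_
      obtain ⟨f, rfl⟩ := Ideal.Quotient.mk_surjective x
      change DirectSum.coeLinearMap (grading h) (decomposePoly h f) = Ideal.Quotient.mk _ f
      induction f using DirectSum.Decomposition.inductionOn
        (homogeneousSubmodule (Fin (N + 1)) L) with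
      | zero => simp
      | homogeneous m => rw [decomposePoly_coe, DirectSum.coeLinearMap_lof]; rfl
      | add f g hf hg => rw [map_add, map_add, hf, hg, map_add])
    (by
      refine DirectSum.addHom_ext' fun n => AddMonoidHom.ext ?_
      rintro ⟨_, f, hf, rfl⟩
      change decomposeQuot hh (DirectSum.coeAddMonoidHom (grading h) (DirectSum.of _ n _)) = _
      rw [DirectSum.coeAddMonoidHom_of]
      exact decomposePoly_coe h ⟨f, hf⟩)

/-- The hypersurface `V(h) = Proj (L[x_0, …, x_N] / (h))` in `ℙ^N` over `L`, for a form `h`. -/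
noncomputable def hypersurface {h : MvPolynomial (Fin (N + 1)) L} {d : ℕ}
    (hh : h.IsHomogeneous d) : Scheme.{u} :=
  letI := gradedAlgebra hh
  Proj (grading h)

/-- A hypersurface over a field of characteristic `p` is a scheme of characteristic `p`. -/
lemma hypersurface_isCharP {h : MvPolynomial (Fin (N + 1)) L} {d : ℕ}
    (hh : h.IsHomogeneous d) (p : ℕ) [CharP L p] : (hypersurface hh).IsCharP p := by
  let := gradedAlgebra hh
  have h0 : (p : grading h 0) = 0 := by
    have := congrArg (algebraMap L (grading h 0)) (CharP.cast_eq_zero L p)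
    rwa [map_natCast, map_zero] at this
  let φ : (grading h 0) →+* Γ(hypersurface hh, ⊤) :=
    (Proj.toSpecZero (grading h)).appTop.hom.comp
      (Scheme.ΓSpecIso (CommRingCat.of (grading h 0))).inv.hom
  have := congrArg φ h0
  rw [map_natCast, map_zero] at this
  exact this

end ProjHypersurface

/-! Write `m` for the ideal of the variables. On `ℙ^N` the sequence `0 → 𝒪(-d) → 𝒪 → 𝒪_D → 0` given
by multiplication by `h`, together with `H^(N-1)(𝒪) = H^N(𝒪) = 0`, identifies `H^(N-1)(D, 𝒪_D)` with
`H^N(ℙ^N, 𝒪(-d))`. The latter has as basis the Laurent monomials of degree `-d` with all exponents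
negative. As `(h t)^p = h · h^(p-1) t^p`, Frobenius becomes `t ↦ h^(p-1) t^p`, read modulo Laurent
polynomials without negative part (`NegZero`).

Injectivity: suppose the class of `h^(p-1) t^p` vanishes, and let `J` be the annihilator of the
class of `t` (`annNeg`). Writing `h^(p-1) = ∑ G_b^p x^b` with `0 ≤ b_i < p` and comparing
coefficients gives `G_b ∈ J`, so `h^(p-1) ∈ J^[p]` (`mem_frobPow_annNeg`). Hence `τ(h^(1-1/p)) ⊆ J`
(`Ideal.testIdeal_one_sub_inv_le`), and by hypothesis `m^(d-N-1)` kills `t`. If a negative exponent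
`a` occurred in `t`, the monomial `x^(-a-1)`, of degree `d-N-1`, would carry it to the exponent
`(-1, …, -1)`, which is still negative: a contradiction. Surjectivity follows, since an injective
`p`-linear endomorphism of a finite-dimensional space over a perfect field is surjective.

The computation is made with alternating Čech cochains, whose values are represented by Laurent
polynomials up to multiples of `h`. No isomorphism between Čech and sheaf cohomology is built:
`bijective_H_map` transfers bijectivity of the map induced by a morphism of sheaves, by dimension
shifting along embeddings into injective sheaves. Its input is Čech acyclicity on affine opens
(`affineExact_structureAbSheaf`). -/

set_option linter.unusedSectionVars false

/-! ### Alternating sums over finite subsets -/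

section AlternatingSums

variable {ι : Type*} [LinearOrder ι] {M : Type*} [AddCommGroup M]

/-- The sign of the position of `i` in the finite set `s`. -/
def posSign (i : ι) (s : Finset ι) : ℤ := (-1) ^ (s.filter (· < i)).card

lemma posSign_mul_self (i : ι) (s : Finset ι) : posSign i s * posSign i s = 1 := by
  rw [posSign, ← mul_pow]; norm_num

lemma posSign_erase_of_lt {i j : ι} {s : Finset ι} (hi : i ∈ s) (hij : i < j) :
    posSign j (s.erase i) = -posSign j s := by
  unfold posSign
  have : s.filter (· < j) = insert i ((s.erase i).filter (· < j)) := by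
    ext k
    simp only [Finset.mem_filter, Finset.mem_insert, Finset.mem_erase]
    by_cases h : k = i
    · subst h; simp [hi, hij]
    · simp [h]
  rw [this, Finset.card_insert_of_notMem (by simp), pow_succ]
  ring

lemma posSign_erase_of_gt {i j : ι} {s : Finset ι} (hij : j < i) :
    posSign j (s.erase i) = posSign j s := by
  unfold posSign
  congr 2
  ext k
  simp only [Finset.mem_filter, Finset.mem_erase]
  exact ⟨fun h => ⟨h.1.2, h.2⟩, fun h => ⟨⟨(h.2.trans hij).ne, h.1⟩, h.2⟩⟩

/-- Removing the smaller index shifts the position of the larger one, but not conversely; hence the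
opposite signs behind `d ∘ d = 0`. -/
lemma posSign_mul_posSign_erase {i j : ι} {s : Finset ι} (hi : i ∈ s) (hj : j ∈ s) (hij : i ≠ j) :
    posSign i s * posSign j (s.erase i) = -(posSign j s * posSign i (s.erase j)) := by
  rcases lt_or_gt_of_ne hij with h | h
  · rw [posSign_erase_of_lt hi h, posSign_erase_of_gt h]; ring
  · rw [posSign_erase_of_gt h, posSign_erase_of_lt hj h]; ring

/-- The alternating sum of the values of `σ` at the sets `t \ {i}`, for `i ∈ t`. -/
def altSum (σ : Finset ι → M) (t : Finset ι) : M :=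
  ∑ i ∈ t, posSign i t • σ (t.erase i)

lemma altSum_congr {σ τ : Finset ι → M} {t : Finset ι}
    (h : ∀ i ∈ t, σ (t.erase i) = τ (t.erase i)) : altSum σ t = altSum τ t :=
  Finset.sum_congr rfl fun i hi => by rw [h i hi]

lemma altSum_eq_zero {σ : Finset ι → M} {t : Finset ι}
    (h : ∀ i ∈ t, σ (t.erase i) = 0) : altSum σ t = 0 :=
  Finset.sum_eq_zero fun i hi => by rw [h i hi, smul_zero]

lemma altSum_add (σ τ : Finset ι → M) : altSum (σ + τ) = altSum σ + altSum τ := by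
  ext t; simp [altSum, Finset.sum_add_distrib]

lemma altSum_sub (σ τ : Finset ι → M) : altSum (σ - τ) = altSum σ - altSum τ := by
  ext t; simp [altSum, smul_sub]

lemma map_altSum {M' F : Type*} [AddCommGroup M'] [FunLike F M M'] [AddMonoidHomClass F M M']
    (f : F) (σ : Finset ι → M) (t : Finset ι) :
    f (altSum σ t) = altSum (fun s => f (σ s)) t := by
  simp [altSum, map_sum, map_zsmul]

lemma altSum_altSum (σ : Finset ι → M) (t : Finset ι) : altSum (altSum σ) t = 0 := by
  simp only [altSum, Finset.smul_sum]
  rw [Finset.sum_sigma']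
  refine Finset.sum_involution (fun x _ => ⟨x.2, x.1⟩) ?_ ?_ ?_ ?_
  · rintro ⟨i, j⟩ h
    simp only [Finset.mem_sigma, Finset.mem_erase] at h
    obtain ⟨hi, hji, hj⟩ := h
    simp only
    rw [smul_smul, smul_smul, Finset.erase_right_comm, ← add_smul,
      posSign_mul_posSign_erase hi hj hji.symm, neg_add_cancel, zero_smul]
  · rintro ⟨i, j⟩ h _ h'
    simp only [Finset.mem_sigma, Finset.mem_erase] at h
    exact h.2.1 (congrArg Sigma.fst h')
  · rintro ⟨i, j⟩ h
    simp only [Finset.mem_sigma, Finset.mem_erase] at h ⊢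
    exact ⟨h.2.2, h.2.1.symm, h.1⟩
  · rintro ⟨i, j⟩ h
    rfl

/-- The contraction of alternating cochains with respect to the index `j`. -/
def contract (j : ι) (σ : Finset ι → M) (s : Finset ι) : M :=
  if j ∈ s then 0 else posSign j (insert j s) • σ (insert j s)

lemma altSum_contract_of_mem (σ : Finset ι → M) {j : ι} {t : Finset ι} (hj : j ∈ t) :
    altSum (contract j σ) t = σ t := by
  rw [altSum, Finset.sum_eq_single_of_mem j hj]
  · simp [contract, Finset.insert_erase hj, smul_smul, posSign_mul_self]
  · intro i _ hij
    simp [contract, hj, hij.symm]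

/-- This is the homotopy identity "`d ∘ contract + contract ∘ d = id`" at `t`; its second term is,
up to sign, the alternating sum assumed to vanish. -/
lemma altSum_contract_of_notMem (σ : Finset ι → M) {j : ι} {t : Finset ι} (hj : j ∉ t)
    (h : altSum σ (insert j t) = 0) : altSum (contract j σ) t = σ t := by
  have hε : ∀ i ∈ t, posSign i t • contract j σ (t.erase i) =
      -(posSign j (insert j t) • posSign i (insert j t) • σ ((insert j t).erase i)) := by
    intro i hi
    have hij : i ≠ j := fun e => hj (e ▸ hi)
    have hE : insert j (t.erase i) = (insert j t).erase i := by
      rw [Finset.erase_insert_of_ne hij.symm]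
    have h1 := posSign_mul_posSign_erase (Finset.mem_insert_of_mem hi) (Finset.mem_insert_self j t)
      hij
    rw [Finset.erase_insert hj] at h1
    have h2 : posSign i t * posSign j ((insert j t).erase i) =
        -(posSign j (insert j t) * posSign i (insert j t)) := by
      have a := posSign_mul_self i t
      have b := posSign_mul_self i (insert j t)
      linear_combination (posSign i t * posSign i (insert j t)) * h1 -
        posSign i t * posSign j ((insert j t).erase i) * b -
        posSign j (insert j t) * posSign i (insert j t) * a
    rw [contract, if_neg (by simp [hj]), hE, smul_smul, h2, neg_smul, smul_smul]
  rw [altSum, Finset.sum_congr rfl hε, Finset.sum_neg_distrib, ← Finset.smul_sum]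
  rw [altSum, Finset.sum_insert hj, Finset.erase_insert hj] at h
  rw [eq_neg_of_add_eq_zero_right h, smul_neg, neg_neg, smul_smul, posSign_mul_self, one_smul]

end AlternatingSums

/-! ### Alternating Čech cochains of abelian sheaves -/

namespace AltCech

open TopologicalSpace Opposite

variable {X : TopCat.{u}} {ι : Type*}

/-- Restriction of sections of an abelian presheaf. -/
def res (F : (Opens X)ᵒᵖ ⥤ AddCommGrpCat.{u}) {U V : Opens X} (h : V ≤ U) :
    F.obj (op U) →+ F.obj (op V) := (F.map (homOfLE h).op).hom

section

variable {F G : (Opens X)ᵒᵖ ⥤ AddCommGrpCat.{u}}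

lemma res_res {U V W : Opens X} (h : V ≤ U) (h' : W ≤ V) (x : F.obj (op U)) :
    res F h' (res F h x) = res F (h'.trans h) x := by
  have : F.map (homOfLE (h'.trans h)).op = F.map (homOfLE h).op ≫ F.map (homOfLE h').op := by
    rw [← F.map_comp]; rfl
  simp only [res, this]
  rfl

lemma res_self {U : Opens X} (h : U ≤ U) (x : F.obj (op U)) : res F h x = x := by
  have : F.map (homOfLE h).op = 𝟙 _ := F.map_id _
  simp only [res, this]
  rfl

lemma app_res (f : F ⟶ G) {U V : Opens X} (h : V ≤ U) (x : F.obj (op U)) :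
    (f.app (op V)).hom (res F h x) = res G h ((f.app (op U)).hom x) :=
  congrArg (fun φ => φ.hom x) (f.naturality (homOfLE h).op)

end

/-- The intersection of the members `V i`, `i ∈ s`, of a family of opens of `W`. -/
def inter (W : Opens X) (V : ι → Opens X) (s : Finset ι) : Opens X := W ⊓ s.inf V

lemma inter_anti (W : Opens X) (V : ι → Opens X) {s t : Finset ι} (h : s ⊆ t) :
    inter W V t ≤ inter W V s := inf_le_inf_left _ (Finset.inf_mono h)

lemma mem_inter {W : Opens X} {V : ι → Opens X} {s : Finset ι} {x : X} :
    x ∈ inter W V s ↔ x ∈ W ∧ ∀ i ∈ s, x ∈ V i := by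
  simp only [inter, Opens.mem_inf, and_congr_right_iff]
  intro _
  classical
  induction s using Finset.induction_on with
  | empty => simp
  | insert a s _ ih => simp [ih]

lemma inter_le (W : Opens X) (V : ι → Opens X) (s : Finset ι) : inter W V s ≤ W := inf_le_left

lemma inter_empty (W : Opens X) (V : ι → Opens X) : inter W V ∅ = W := by simp [inter]

/-- The augmented alternating cochains of `F` for the family `V` of opens of `W`, all degrees
together: the degree `k` part consists of the values at the sets of cardinality `k`. -/
abbrev Cochain (F : (Opens X)ᵒᵖ ⥤ AddCommGrpCat.{u}) (W : Opens X) (V : ι → Opens X) :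
    Type _ := ∀ s : Finset ι, F.obj (op (inter W V s))

variable [LinearOrder ι] {F G : (Opens X)ᵒᵖ ⥤ AddCommGrpCat.{u}} {W : Opens X} {V : ι → Opens X}

/-- The values of a cochain on the subsets of `T`, restricted to the intersection for `T`. -/
def resTo (T : Finset ι) (c : Cochain F W V) (s : Finset ι) : F.obj (op (inter W V T)) :=
  if h : s ⊆ T then res F (inter_anti W V h) (c s) else 0

/-- The Čech differential. -/
def d (c : Cochain F W V) : Cochain F W V := fun t => altSum (resTo t c) t

/-- Restricting everything to one open set turns statements about `d` into statements about `altSum`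
in a single group. -/
lemma res_d {t T : Finset ι} (h : t ⊆ T) (c : Cochain F W V) :
    res F (inter_anti W V h) (d c t) = altSum (resTo T c) t := by
  rw [d, map_altSum]
  refine altSum_congr fun i hi => ?_
  have h1 : t.erase i ⊆ t := Finset.erase_subset i t
  simp only [resTo, dif_pos h1, dif_pos (h1.trans h), res_res]

lemma d_congr {c c' : Cochain F W V} {t : Finset ι}
    (h : ∀ i ∈ t, c (t.erase i) = c' (t.erase i)) : d c t = d c' t :=
  altSum_congr fun i hi => by simp only [resTo, h i hi]

lemma d_eq_zero {c : Cochain F W V} {t : Finset ι}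
    (h : ∀ i ∈ t, c (t.erase i) = 0) : d c t = 0 :=
  altSum_eq_zero fun i hi => by simp [resTo, h i hi]

lemma d_d (c : Cochain F W V) : d (d c) = 0 := by
  funext t
  have : resTo t (d c) = fun s => if s ⊆ t then altSum (resTo t c) s else 0 := by
    funext s
    by_cases h : s ⊆ t
    · simp [resTo, h, res_d]
    · simp [resTo, h]
  rw [d, this, Pi.zero_apply, ← altSum_altSum (resTo t c) t]
  exact altSum_congr fun i _ => if_pos (Finset.erase_subset i t)

lemma d_singleton (c : Cochain F W V) (i : ι) :
    d c {i} = res F (inter_anti W V (Finset.empty_subset {i})) (c ∅) := by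
  -- The type of `c t` depends on `t`, so the identity `{i}.erase i = ∅` is used through a variable
  -- set.
  have h : ∀ t : Finset ι, t = ∅ → ∀ h : t ⊆ {i},
      res F (inter_anti W V h) (c t) = res F (inter_anti W V (Finset.empty_subset {i})) (c ∅) := by
    rintro _ rfl _; rfl
  have h1 : posSign i {i} = 1 := by simp [posSign, Finset.filter_singleton]
  rw [d, altSum, Finset.sum_singleton, h1, one_smul, resTo, dif_pos (Finset.erase_subset i {i}),
    h _ (Finset.erase_singleton i)]
  exact Finset.erase_subset _ _

/-- The cochain of the restrictions of a section over `W`. -/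
def const (V : ι → Opens X) (x : F.obj (op W)) : Cochain F W V := fun s => res F (inter_le W V s) x

lemma d_const_singleton (x : F.obj (op W)) (i : ι) :
    d (const V x) {i} = res F (inter_le W V {i}) x := by
  rw [d_singleton, const, res_res]

lemma resTo_add (T : Finset ι) (c c' : Cochain F W V) :
    resTo T (c + c') = resTo T c + resTo T c' := by
  funext s; by_cases h : s ⊆ T <;> simp [resTo, h]

lemma resTo_sub (T : Finset ι) (c c' : Cochain F W V) :
    resTo T (c - c') = resTo T c - resTo T c' := by
  funext s; by_cases h : s ⊆ T <;> simp [resTo, h]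

lemma d_add (c c' : Cochain F W V) : d (c + c') = d c + d c' := by
  funext t; simp [d, resTo_add, altSum_add]

lemma d_sub (c c' : Cochain F W V) : d (c - c') = d c - d c' := by
  funext t; simp [d, resTo_sub, altSum_sub]

lemma d_zero : d (0 : Cochain F W V) = 0 := by
  funext t; exact d_eq_zero fun _ _ => rfl

/-- The map on cochains induced by a morphism of presheaves. -/
def map (f : F ⟶ G) (c : Cochain F W V) : Cochain G W V := fun s => (f.app _).hom (c s)

lemma map_d (f : F ⟶ G) (c : Cochain F W V) : map f (d c) = d (map f c) := by
  funext t
  simp only [map, d, map_altSum]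
  refine altSum_congr fun i _ => ?_
  simp only [resTo, dif_pos (Finset.erase_subset i t), app_res]
  rfl

omit [LinearOrder ι] in
lemma map_add (f : F ⟶ G) (c c' : Cochain F W V) : map f (c + c') = map f c + map f c' := by
  funext t; simp [map]

omit [LinearOrder ι] in
lemma map_sub (f : F ⟶ G) (c c' : Cochain F W V) : map f (c - c') = map f c - map f c' := by
  funext t; simp [map]

variable (F W V) in
/-- The augmented alternating Čech complex of `F` is exact in all degrees. -/
def Exact : Prop := ∀ c : Cochain F W V, d c = 0 → ∃ u, d u = c

/-- Exactness passes to retracts. -/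
lemma Exact.of_retract {i : F ⟶ G} {r : G ⟶ F} (hir : i ≫ r = 𝟙 F) (hG : Exact G W V) :
    Exact F W V := by
  intro c hc
  obtain ⟨u, hu⟩ := hG (map i c) (by rw [← map_d, hc]; funext t; simp [map])
  refine ⟨map r u, ?_⟩
  rw [← map_d, hu]
  funext t
  exact congrArg (fun φ => (φ.app (op (inter W V t))).hom (c t)) hir

end AltCech

/-! ### Čech exactness for injective sheaves -/

namespace AltCech

open TopologicalSpace Opposite

variable {X : TopCat.{u}}

/-- The presheaf of all families of elements of the groups `T x`. -/
def productPresheaf (T : X → AddCommGrpCat.{u}) : (Opens X)ᵒᵖ ⥤ AddCommGrpCat.{u} where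
  obj U := AddCommGrpCat.of (∀ x : U.unop, T x)
  map {U V} i := AddCommGrpCat.ofHom
    { toFun := fun g x => g (i.unop x)
      map_zero' := rfl
      map_add' := fun _ _ => rfl }

lemma productPresheaf_isSheaf (T : X → AddCommGrpCat.{u}) :
    TopCat.Presheaf.IsSheaf (productPresheaf T) :=
  (TopCat.Presheaf.isSheaf_iff_isSheaf_comp (forget AddCommGrpCat.{u}) _).2
    (TopCat.Presheaf.toTypes_isSheaf X fun x => T x)

/-- The sheaf of all families of elements of the groups `T x`. -/
def productSheaf (T : X → AddCommGrpCat.{u}) :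
    Sheaf (Opens.grothendieckTopology X) AddCommGrpCat.{u} :=
  ⟨productPresheaf T, productPresheaf_isSheaf T⟩

variable {ι : Type*} [LinearOrder ι]

/-- Sections are arbitrary families, so a contraction may be chosen point by point: at `x`, contract
along an index `j` with `x ∈ V j`. -/
lemma exact_productSheaf (T : X → AddCommGrpCat.{u}) {W : Opens X} {V : ι → Opens X}
    (hW : W ≤ ⨆ i, V i) : Exact (productSheaf T).obj W V := by
  classical
  intro c hc
  choose j hj using fun x : W => Opens.mem_iSup.1 (hW x.2)
  let v (x : X) (s : Finset ι) : T x :=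
    if h : x ∈ inter W V s then (c s : ∀ x : inter W V s, T x) ⟨x, h⟩ else 0
  have hv : ∀ (c' : Cochain (productSheaf T).obj W V) (t : Finset ι) (x : inter W V t),
      (d c' t : ∀ x : inter W V t, T x) x = altSum (fun s => 
        if h : x.1 ∈ inter W V s then (c' s : ∀ x : inter W V s, T x) ⟨x, h⟩ else 0) t := by
    intro c' t x
    let ev : (productSheaf T).obj.obj (op (inter W V t)) →+ T x :=
      Pi.evalAddMonoidHom (fun x : inter W V t => T x) x
    have := map_altSum ev (resTo t c') t
    refine this.trans (altSum_congr fun i _ => ?_)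
    have hm : x.1 ∈ inter W V (t.erase i) := inter_anti W V (Finset.erase_subset i t) x.2
    simp only [resTo, dif_pos hm, dif_pos (Finset.erase_subset i t)]
    rfl
  refine ⟨fun s (x : inter W V s) => contract (j ⟨x, (mem_inter.1 x.2).1⟩) (v x) s, ?_⟩
  funext t
  refine funext fun (x : inter W V t) => ?_
  have hx : x.1 ∈ inter W V t := x.2
  refine (hv _ t x).trans ?_
  set k : ι := j ⟨x, (mem_inter.1 hx).1⟩
  have hxk : x.1 ∈ V k := hj ⟨x, (mem_inter.1 hx).1⟩
  have hins : x.1 ∈ inter W V (insert k t) := by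
    rw [mem_inter] at hx ⊢
    refine ⟨hx.1, fun i hi => ?_⟩
    rcases Finset.mem_insert.1 hi with rfl | hi
    exacts [hxk, hx.2 i hi]
  have e1 : altSum (fun s => if h : x.1 ∈ inter W V s then contract k (v x) s else 0) t
      = altSum (contract k (v x)) t :=
    altSum_congr fun i _ => dif_pos (inter_anti W V (Finset.erase_subset i t) x.2)
  have e2 : v x t = (c t : ∀ x : inter W V t, T x) x := dif_pos hx
  refine e1.trans (Eq.trans ?_ e2)
  by_cases hjt : k ∈ t
  · exact altSum_contract_of_mem _ hjt
  · refine altSum_contract_of_notMem _ hjt ?_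
    refine (hv c _ ⟨x, hins⟩).symm.trans ?_
    rw [hc]
    rfl

/-- The embedding of a sheaf in the sheaf of families of germs. -/
noncomputable def toGerms (A : Sheaf (Opens.grothendieckTopology X) AddCommGrpCat.{u}) :
    A ⟶ productSheaf fun x => TopCat.Presheaf.stalk A.obj x where
  hom :=
    { app := fun U => AddCommGrpCat.ofHom
        { toFun := fun s (x : U.unop) => (TopCat.Presheaf.germ A.obj U.unop x.1 x.2) s
          map_zero' := by funext x; exact map_zero _
          map_add' := fun a b => by funext x; exact _root_.map_add _ a b }
      naturality := fun U V i => by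
        ext s
        funext x
        exact TopCat.Presheaf.germ_res_apply A.obj i.unop x.1 x.2 s }

instance mono_toGerms (A : Sheaf (Opens.grothendieckTopology X) AddCommGrpCat.{u}) :
    Mono (toGerms A) := by
  have : ∀ U, Mono ((toGerms A).hom.app U) := by
    intro U
    rw [AddCommGrpCat.mono_iff_injective]
    intro a b hab
    refine TopCat.Presheaf.section_ext A U.unop a b fun x hx => ?_
    exact congrFun hab ⟨x, hx⟩
  have : Mono (toGerms A).hom := NatTrans.mono_of_mono_app _
  exact (sheafToPresheaf _ _).mono_of_mono_map this

/-- The augmented Čech complex of an injective sheaf is exact. -/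
lemma exact_of_injective (I : Sheaf (Opens.grothendieckTopology X) AddCommGrpCat.{u})
    [Injective I] {W : Opens X} {V : ι → Opens X} (hW : W ≤ ⨆ i, V i) : Exact I.obj W V :=
  -- The embedding into families of germs splits because `I` is injective.
  (exact_productSheaf _ hW).of_retract (i := (toGerms I).hom)
    (r := (Injective.factorThru (𝟙 I) (toGerms I)).hom)
    (congrArg (fun f => f.hom) (Injective.comp_factorThru (𝟙 I) (toGerms I)))

end AltCech

/-! ### Čech exactness in short exact sequences, and surjectivity on affine sections -/

namespace AltCech

open TopologicalSpace Opposite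

section

variable {X : TopCat.{u}} {S : ShortComplex (Sheaf (Opens.grothendieckTopology X) AddCommGrpCat.{u})}

lemma app_injective (hS : S.ShortExact) (U : Opens X) :
    Function.Injective (S.f.hom.app (op U)).hom := by
  have := hS.mono_f
  have : Mono S.f.hom := inferInstanceAs (Mono ((sheafToPresheaf _ _).map S.f))
  exact (AddCommGrpCat.mono_iff_injective _).1 inferInstance

lemma app_f_app_g (U : Opens X) (x : S.X₁.obj.obj (op U)) :
    (S.g.hom.app (op U)).hom ((S.f.hom.app (op U)).hom x) = 0 :=
  congrArg (fun φ => (φ.hom.app (op U)).hom x) S.zero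

lemma exists_of_app_g_eq_zero (hS : S.ShortExact) {U : Opens X} (x : S.X₂.obj.obj (op U))
    (hx : (S.g.hom.app (op U)).hom x = 0) : ∃ y, (S.f.hom.app (op U)).hom y = x :=
  TopCat.Sheaf.sections_exact_of_left_exact hS.exact hS.mono_f x hx

lemma eq_zero_of_res_eq_zero (A : Sheaf (Opens.grothendieckTopology X) AddCommGrpCat.{u})
    {ι : Type*} {W : Opens X} {V : ι → Opens X} (hW : W ≤ ⨆ i, V i) (hV : ∀ i, V i ≤ W)
    (x : A.obj.obj (op W)) (hx : ∀ i, res A.obj (hV i) x = 0) : x = 0 :=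
  TopCat.Sheaf.eq_of_locally_eq' (F := A) V W (fun i => homOfLE (hV i)) hW x 0
    fun i => (hx i).trans (map_zero (res A.obj (hV i))).symm

variable {ι : Type*} [LinearOrder ι] {W : Opens X} {V : ι → Opens X}

lemma eq_of_d_singleton_eq (A : Sheaf (Opens.grothendieckTopology X) AddCommGrpCat.{u})
    (hW : W ≤ ⨆ i, V i) (hV : ∀ i, V i ≤ W) (c : Cochain A.obj W V) (x : A.obj.obj (op W))
    (h : ∀ i, d c {i} = res _ (inter_le W V {i}) x) : res _ (inter_empty W V).ge (c ∅) = x := by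
  rw [← sub_eq_zero]
  refine eq_zero_of_res_eq_zero A hW hV _ fun i => ?_
  have hVi : V i ≤ inter W V {i} := by simp [inter, hV i]
  have e := congrArg (res _ hVi) (h i)
  rw [d_singleton, res_res, res_res] at e
  rw [_root_.map_sub, res_res, sub_eq_zero]
  exact e

omit [LinearOrder ι] in
lemma map_f_injective (hS : S.ShortExact) :
    Function.Injective (map (W := W) (V := V) S.f.hom) := fun _ _ h =>
  funext fun s => app_injective hS _ (congrFun h s)

omit [LinearOrder ι] in
lemma map_g_map_f (c : Cochain S.X₁.obj W V) : map S.g.hom (map S.f.hom c) = 0 :=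
  funext fun _ => app_f_app_g _ _

omit [LinearOrder ι] in
lemma exists_of_map_g_eq_zero (hS : S.ShortExact) (b : Cochain S.X₂.obj W V)
    (hb : map S.g.hom b = 0) : ∃ a, map S.f.hom a = b := by
  choose a ha using fun s => exists_of_app_g_eq_zero hS (b s) (congrFun hb s)
  exact ⟨a, funext ha⟩

/-- The common diagram chase: `d b` comes from a cocycle of `S.X₁`, hence from some `d a'`, and then
`b - f a'` is a cocycle of `S.X₂`, hence some `d u`. -/
lemma exists_map_g_eq_d (hS : S.ShortExact) (h₁ : Exact S.X₁.obj W V) (h₂ : Exact S.X₂.obj W V)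
    (b : Cochain S.X₂.obj W V) (hb : map S.g.hom (d b) = 0) :
    ∃ u, map S.g.hom b = d (map S.g.hom u) := by
  obtain ⟨a, ha⟩ := exists_of_map_g_eq_zero hS _ hb
  obtain ⟨a', rfl⟩ := h₁ a (map_f_injective hS (by
    rw [map_d, ha, d_d]; funext s; simp [map]))
  obtain ⟨u, hu⟩ := h₂ (b - map S.f.hom a') (by rw [d_sub, ← ha, map_d, sub_self])
  refine ⟨u, ?_⟩
  rw [← map_d, hu, map_sub, map_g_map_f, sub_zero]

lemma exact_of_shortExact (hS : S.ShortExact) (h₁ : Exact S.X₁.obj W V)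
    (h₂ : Exact S.X₂.obj W V)
    (hg : ∀ s, Function.Surjective (S.g.hom.app (op (inter W V s))).hom) :
    Exact S.X₃.obj W V := by
  intro c hc
  choose b hb using fun s => hg s (c s)
  have hb : map S.g.hom b = c := funext hb
  obtain ⟨u, hu⟩ := exists_map_g_eq_d hS h₁ h₂ b (by rw [map_d, hb, hc])
  exact ⟨map S.g.hom u, by rw [← hu, hb]⟩

/-- Local lifts differ by sections of `S.X₁`; exactness for `S.X₁` and `S.X₂` corrects them into
restrictions of a single section. -/
lemma exists_lift_of_locally (hS : S.ShortExact) (h₁ : Exact S.X₁.obj W V)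
    (h₂ : Exact S.X₂.obj W V) (hW : W ≤ ⨆ i, V i) (hV : ∀ i, V i ≤ W)
    (q : S.X₃.obj.obj (op W))
    (hq : ∀ i, ∃ b, (S.g.hom.app (op (V i))).hom b = res S.X₃.obj (hV i) q) :
    ∃ b, (S.g.hom.app (op W)).hom b = q := by
  -- With `q` placed at the empty set only, `d c` lives on singletons, where lifts are given.
  let c : Cochain S.X₃.obj W V := fun s => if s = ∅ then res _ (inter_le W V s) q else 0
  have hsingle : ∀ i, d c {i} = res _ (inter_le W V _) q := by
    intro i
    rw [d_singleton]
    simp only [c, if_true, res_res]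
  have hlift : ∀ s, ∃ b, (S.g.hom.app (op (inter W V s))).hom b = d c s := by
    intro s
    by_cases hs : ∃ i, s = {i}
    · obtain ⟨i, rfl⟩ := hs
      obtain ⟨b, hb⟩ := hq i
      have hVi : inter W V {i} ≤ V i := by simp [inter]
      exact ⟨res _ hVi b, by rw [app_res, hb, res_res, hsingle]⟩
    · refine ⟨0, ?_⟩
      rw [map_zero, d_eq_zero]
      intro i hi
      refine if_neg fun h => hs ⟨i, ?_⟩
      rw [← Finset.insert_erase hi, h]
      rfl
  choose b hb using hlift
  have hb : map S.g.hom b = d c := funext hb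
  obtain ⟨u, hu⟩ := exists_map_g_eq_d hS h₁ h₂ b (by rw [map_d, hb, d_d])
  refine ⟨res _ (inter_empty W V).ge (u ∅), ?_⟩
  rw [app_res]
  refine eq_of_d_singleton_eq S.X₃ hW hV (map S.g.hom u) q fun i => ?_
  rw [← hu, hb, hsingle]

end

section Schemes

variable {X : Scheme.{u}}

/-- Exactness of the augmented Čech complexes of a sheaf for the standard coverings of the
affine opens. -/
def AffineExact (A : Sheaf (Opens.grothendieckTopology X) AddCommGrpCat.{u}) : Prop :=
  ∀ (U : X.Opens) (_ : IsAffineOpen U) (n : ℕ) (f : Fin n → Γ(X, U)),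
    Ideal.span (Set.range f) = ⊤ → Exact A.obj U fun i => X.basicOpen (f i)

lemma inter_basicOpen {ι : Type*} {U : X.Opens} (f : ι → Γ(X, U)) (s : Finset ι) :
    inter U (fun i => X.basicOpen (f i)) s = X.basicOpen (∏ i ∈ s, f i) := by
  classical
  induction s using Finset.induction_on with
  | empty => simp [inter]
  | insert a s ha ih =>
    rw [Finset.prod_insert ha, Scheme.basicOpen_mul, ← ih, inter, inter, Finset.inf_insert,
      inf_left_comm]

lemma le_iSup_basicOpen {U : X.Opens} {ι : Type*} (f : ι → Γ(X, U))
    (hf : Ideal.span (Set.range f) = ⊤) : U ≤ ⨆ i, X.basicOpen (f i) := by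
  have := (iSup_basicOpen_of_span_eq_top U _ hf).ge
  rwa [iSup_range] at this

variable {S : ShortComplex (Sheaf (Opens.grothendieckTopology X) AddCommGrpCat.{u})}

/-- The functions `f` for which `q` lifts over `D(f)` generate the unit ideal, so finitely many do,
and the lifts are glued by `exists_lift_of_locally`. -/
lemma AffineExact.app_surjective (hS : S.ShortExact) (h₁ : AffineExact S.X₁) [Injective S.X₂]
    {U : X.Opens} (hU : IsAffineOpen U) : Function.Surjective (S.g.hom.app (op U)).hom := by
  intro q
  let s : Set Γ(X, U) := {f | ∃ b, (S.g.hom.app (op (X.basicOpen f))).hom b =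
    res S.X₃.obj (X.basicOpen_le f) q}
  have hs : Ideal.span s = ⊤ := by
    rw [← hU.iSup_basicOpen_eq_self_iff]
    refine le_antisymm (iSup_le fun f => X.basicOpen_le _) fun x hx => ?_
    have hloc := (TopCat.Sheaf.isLocallySurjective_iff_epi S.g).2 hS.epi_g
    obtain ⟨V, hVU, ⟨b, hb⟩, hxV⟩ :=
      (TopCat.Presheaf.isLocallySurjective_iff S.g.hom).1 hloc U q x hx
    obtain ⟨f, hfV, hxf⟩ := hU.exists_basicOpen_le ⟨x, hxV⟩ hx
    refine Opens.mem_iSup.2 ⟨⟨f, res _ hfV b, ?_⟩, hxf⟩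
    have hb' : (S.g.hom.app (op V)).hom b = res _ hVU q := hb
    rw [app_res, hb', res_res]
  obtain ⟨s', hs's, hs'⟩ := (Ideal.span_eq_top_iff_finite _).1 hs
  let f : Fin s'.card → Γ(X, U) := fun i => (s'.equivFin.symm i).1
  have hf : Set.range f = s' := by
    change Set.range (Subtype.val ∘ s'.equivFin.symm) = _
    rw [EquivLike.range_comp, Subtype.range_coe]
  have hf' : Ideal.span (Set.range f) = ⊤ := by rw [hf, hs']
  have hle := le_iSup_basicOpen f hf'
  exact exists_lift_of_locally hS (h₁ U hU _ f hf') (exact_of_injective _ hle) hle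
    (fun i => X.basicOpen_le _) q fun i => hs's (s'.equivFin.symm i).2

/-- This lets dimension shifting be iterated: the cokernel of an embedding into an injective sheaf
inherits the property. -/
lemma AffineExact.of_shortExact (hS : S.ShortExact) (h₁ : AffineExact S.X₁) [Injective S.X₂] :
    AffineExact S.X₃ := by
  intro U hU n f hf
  refine exact_of_shortExact hS (h₁ U hU n f hf) (exact_of_injective _ (le_iSup_basicOpen f hf))
    fun s => ?_
  rw [inter_basicOpen]
  exact h₁.app_surjective hS (hU.basicOpen _)

end Schemes

end AltCech

/-! ### Čech acyclicity of the structure sheaf on affine opens -/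

namespace AltCech

open TopologicalSpace Opposite

variable {X : Scheme.{u}}

/-- Restriction of sections of the structure sheaf, as a ring homomorphism. -/
def resHom {U V : X.Opens} (h : V ≤ U) : Γ(X, U) →+* Γ(X, V) := (X.presheaf.map (homOfLE h).op).hom

/-- The sections of the sheaf of abelian groups underlying the structure sheaf. -/
abbrev Sec (U : X.Opens) : Type u := X.structureAbSheaf.obj.obj (op U)

/-- Multiplication by a function, on the sections of the structure sheaf. -/
noncomputable def mulSec {U : X.Opens} (a : Γ(X, U)) : Sec U →+ Sec U :=
  (AddMonoidHom.mulLeft a : Γ(X, U) →+ Γ(X, U))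

lemma mulSec_mul {U : X.Opens} (a b : Γ(X, U)) (x : Sec U) :
    mulSec (a * b) x = mulSec a (mulSec b x) := mul_assoc a b (show Γ(X, U) from x)

lemma mulSec_add {U : X.Opens} (a b : Γ(X, U)) (x : Sec U) :
    mulSec (a + b) x = mulSec a x + mulSec b x := add_mul a b (show Γ(X, U) from x)

lemma mulSec_one {U : X.Opens} (x : Sec U) : mulSec (1 : Γ(X, U)) x = x :=
  one_mul (show Γ(X, U) from x)

lemma mulSec_zero {U : X.Opens} (x : Sec U) : mulSec (0 : Γ(X, U)) x = 0 :=
  zero_mul (show Γ(X, U) from x)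

lemma res_mulSec {U V : X.Opens} (h : V ≤ U) (a : Γ(X, U)) (x : Sec U) :
    res _ h (mulSec a x) = mulSec (resHom h a) (res _ h x) :=
  map_mul (resHom h) a x

lemma resHom_resHom {U V W : X.Opens} (h : V ≤ U) (h' : W ≤ V) (x : Γ(X, U)) :
    resHom h' (resHom h x) = resHom (h'.trans h) x :=
  res_res (F := X.structureAbSheaf.obj) h h' x

lemma exists_res_eq_mulSec {U V : X.Opens} (hU : IsAffineOpen U) (f : Γ(X, U)) (h : V ≤ U)
    (hV : V = X.basicOpen f) (x : Sec V) : ∃ (m : ℕ) (w : Sec U),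
      res _ h w = mulSec (resHom h f ^ m) x := by
  have := hU.isLocalization_of_eq_basicOpen f (homOfLE h) hV
  let _ := (X.presheaf.map (homOfLE h).op).hom.toAlgebra
  obtain ⟨m, w, hw⟩ := IsLocalization.Away.surj f (show Γ(X, V) from x)
  exact ⟨m, w, hw.symm.trans (mul_comm _ _)⟩

lemma exists_mulSec_pow_eq_zero {U V : X.Opens} (hU : IsAffineOpen U) (f : Γ(X, U)) (h : V ≤ U)
    (hV : V = X.basicOpen f) (x : Sec U) (hx : res _ h x = 0) : ∃ m : ℕ, mulSec (f ^ m) x = 0 := by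
  have := hU.isLocalization_of_eq_basicOpen f (homOfLE h) hV
  let _ := (X.presheaf.map (homOfLE h).op).hom.toAlgebra
  obtain ⟨⟨_, m, rfl⟩, hm⟩ := (IsLocalization.map_eq_zero_iff (Submonoid.powers f) Γ(X, V)
    (show Γ(X, U) from x)).1 hx
  exact ⟨m, hm⟩

variable {ι : Type*} {U : X.Opens} {V : ι → X.Opens}

/-- The action of `Γ(X, U)` on the Čech cochains of the structure sheaf. -/
noncomputable def mulCochain (a : Γ(X, U)) (c : Cochain X.structureAbSheaf.obj U V) :
    Cochain X.structureAbSheaf.obj U V :=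
  fun s => mulSec (resHom (inter_le _ _ _) a) (c s)

lemma mulCochain_mul (a b : Γ(X, U)) (c : Cochain X.structureAbSheaf.obj U V) :
    mulCochain (a * b) c = mulCochain a (mulCochain b c) := by
  funext s
  simp only [mulCochain, map_mul, mulSec_mul]

lemma mulCochain_add (a b : Γ(X, U)) (c : Cochain X.structureAbSheaf.obj U V) :
    mulCochain (a + b) c = mulCochain a c + mulCochain b c := by
  funext s
  simp only [mulCochain, _root_.map_add, mulSec_add, Pi.add_apply]

lemma mulCochain_one (c : Cochain X.structureAbSheaf.obj U V) : mulCochain 1 c = c := by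
  funext s
  simp only [mulCochain, map_one, mulSec_one]

lemma mulCochain_zero (c : Cochain X.structureAbSheaf.obj U V) : mulCochain 0 c = 0 := by
  funext s
  simp only [mulCochain, _root_.map_zero, mulSec_zero, Pi.zero_apply]

variable [LinearOrder ι]

lemma resTo_mulCochain (a : Γ(X, U)) (c : Cochain X.structureAbSheaf.obj U V) (T s : Finset ι) :
    resTo T (mulCochain a c) s = mulSec (resHom (inter_le _ _ _) a) (resTo T c s) := by
  by_cases h : s ⊆ T
  · simp only [resTo, dif_pos h, mulCochain, res_mulSec, resHom_resHom]
  · simp only [resTo, dif_neg h, _root_.map_zero]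

lemma d_mulCochain (a : Γ(X, U)) (c : Cochain X.structureAbSheaf.obj U V) :
    d (mulCochain a c) = mulCochain a (d c) := by
  funext t
  simp only [d, mulCochain, map_altSum]
  exact altSum_congr fun i _ => resTo_mulCochain a c t _

/-- The ideal of the sections whose product with the cochain `c` is a coboundary. -/
def boundaryIdeal (c : Cochain X.structureAbSheaf.obj U V) : Ideal Γ(X, U) where
  carrier := {a | ∃ u, d u = mulCochain a c}
  zero_mem' := ⟨0, by rw [d_zero, mulCochain_zero]⟩
  add_mem' := by
    rintro a b ⟨u, hu⟩ ⟨v, hv⟩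
    exact ⟨u + v, by rw [d_add, hu, hv, mulCochain_add]⟩
  smul_mem' := by
    rintro a b ⟨u, hu⟩
    exact ⟨mulCochain a u, by rw [d_mulCochain, hu, smul_eq_mul, mulCochain_mul]⟩

lemma inter_insert_eq_basicOpen (f : ι → Γ(X, U)) (j : ι) (s : Finset ι) :
    inter U (fun i => X.basicOpen (f i)) (insert j s) =
      X.basicOpen (resHom (inter_le U (fun i => X.basicOpen (f i)) s) (f j)) := by
  refine Eq.trans ?_ (Scheme.basicOpen_res X (f j) (homOfLE _).op).symm
  rw [inter, inter, Finset.inf_insert, inf_comm (X.basicOpen _), ← inf_assoc]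

/-- On `D(f j)` contraction along `j` bounds `c`. Values on `D(f j)` extend after multiplication by
a power of `f j`, and an identity valid on `D(f j)` holds after multiplication by another power. -/
lemma mem_radical_boundaryIdeal [Finite ι] (hU : IsAffineOpen U) (f : ι → Γ(X, U))
    (c : Cochain X.structureAbSheaf.obj U fun i => X.basicOpen (f i)) (hc : d c = 0) (j : ι) :
    f j ∈ (boundaryIdeal c).radical := by
  have := Fintype.ofFinite ι
  let V : ι → X.Opens := fun i => X.basicOpen (f i)
  have haff : ∀ s, IsAffineOpen (inter U V s) := fun s => by
    rw [inter_basicOpen]; exact hU.basicOpen _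
  have hins : ∀ s : Finset ι, inter U V (insert j s) ≤ inter U V s := fun s =>
    inter_anti U V (Finset.subset_insert _ _)
  let ρ (s : Finset ι) : Γ(X, U) →+* Γ(X, inter U V s) := resHom (inter_le U V s)
  have key1 : ∀ s, ∃ (m : ℕ) (w : Sec (inter U V s)),
      res _ (hins s) w = mulSec (ρ _ (f j) ^ m) (c (insert j s)) := by
    intro s
    obtain ⟨m, w, hw⟩ := exists_res_eq_mulSec (haff s) (ρ s (f j)) (hins s)
      (inter_insert_eq_basicOpen f j s) (c (insert j s))
    exact ⟨m, w, by rw [hw]; simp only [ρ, resHom_resHom]⟩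
  choose m w hw using key1
  let M := Finset.univ.sup m
  -- The exponents `m s` are raised to their maximum `M`, so that one factor `f j ^ M` serves for
  -- all `s`.
  let w' (s : Finset ι) : Sec (inter U V s) := mulSec (ρ s (f j) ^ (M - m s)) (w s)
  have hw' : ∀ s, res _ (hins s) (w' s) = mulCochain (f j ^ M) c (insert j s) := by
    intro s
    have hm : m s ≤ M := Finset.le_sup (Finset.mem_univ s)
    change res _ (hins s) (mulSec (ρ s (f j) ^ (M - m s)) (w s)) =
      mulSec (ρ _ (f j ^ M)) (c (insert j s))
    rw [res_mulSec, hw, map_pow, map_pow, ← Nat.sub_add_cancel hm, pow_add, mulSec_mul,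
      Nat.sub_add_cancel hm]
    simp only [ρ, resHom_resHom]
  let u : Cochain X.structureAbSheaf.obj U V := fun s =>
    if j ∈ s then 0 else posSign j (insert j s) • w' s
  have hu : ∀ t, res _ (hins t) (d u t) = res _ (hins t) (mulCochain (f j ^ M) c t) := by
    intro t
    set T := insert j t
    have htT : t ⊆ T := Finset.subset_insert _ _
    set σ := resTo T (mulCochain (f j ^ M) c)
    have e1 : altSum (resTo T u) t = altSum (contract j σ) t := by
      refine altSum_congr fun i _ => ?_
      have hiT : t.erase i ⊆ T := (Finset.erase_subset i t).trans htT
      rw [resTo, dif_pos hiT]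
      by_cases hj : j ∈ t.erase i
      · simp only [u, contract, if_pos hj, _root_.map_zero]
      · have hjT : insert j (t.erase i) ⊆ T :=
          Finset.insert_subset (Finset.mem_insert_self _ _) hiT
        simp only [u, contract, if_neg hj, σ, resTo, dif_pos hjT]
        rw [map_zsmul]
        congr 1
        rw [← hw', res_res]
    have e2 : altSum (contract j σ) t = σ t := by
      by_cases hj : j ∈ t
      · exact altSum_contract_of_mem _ hj
      · refine altSum_contract_of_notMem _ hj ?_
        have : d (mulCochain (f j ^ M) c) T = 0 := by
          rw [d_mulCochain, hc]; exact _root_.map_zero (mulSec _)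
        exact this
    have e3 : σ t = res _ (hins t) (mulCochain (f j ^ M) c t) := dif_pos htT
    exact (res_d htT u).trans (e1.trans (e2.trans e3))
  -- The identity `hu` holds only after restriction to `D(f j)`; a further power of `f j` removes
  -- the restriction.
  have key2 : ∀ t, ∃ k : ℕ, mulSec (ρ t (f j) ^ k) (d u t - mulCochain (f j ^ M) c t) = 0 :=
    fun t => exists_mulSec_pow_eq_zero (haff t) (ρ t (f j)) (hins t)
      (inter_insert_eq_basicOpen f j t) _ (by rw [_root_.map_sub, hu, sub_self])
  choose k hk using key2
  let K := Finset.univ.sup k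
  refine ⟨K + M, mulCochain (f j ^ K) u, ?_⟩
  rw [d_mulCochain, pow_add, mulCochain_mul]
  funext t
  have hkK : k t ≤ K := Finset.le_sup (Finset.mem_univ t)
  change mulSec (ρ t (f j ^ K)) (d u t) = mulSec (ρ t (f j ^ K)) (mulCochain (f j ^ M) c t)
  rw [← sub_eq_zero, ← _root_.map_sub, map_pow, ← Nat.sub_add_cancel hkK, pow_add, mulSec_mul, hk,
    _root_.map_zero]

lemma affineExact_structureAbSheaf (X : Scheme.{u}) : AffineExact X.structureAbSheaf := by
  intro U hU n f hf c hc
  have h1 : (boundaryIdeal c).radical = ⊤ := by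
    rw [eq_top_iff, ← hf, Ideal.span_le]
    rintro _ ⟨j, rfl⟩
    exact mem_radical_boundaryIdeal hU f c hc j
  rw [Ideal.radical_eq_top] at h1
  obtain ⟨u, hu⟩ : (1 : Γ(X, U)) ∈ boundaryIdeal c := h1 ▸ Submodule.mem_top
  exact ⟨u, by rw [hu, mulCochain_one]⟩

end AltCech

/-! ### Diagram chases for connecting maps of `Ext` -/

namespace CategoryTheory.Abelian.Ext

universe v w

variable {C : Type u} [Category.{v} C] [Abelian C] [HasExt.{w} C]

/-- As `Ext L S.X₂ (n + 1)` vanishes, every class is some `δ x`. If its image is zero, `φ.τ₃ x`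
comes from `S'.X₂`, so by hypothesis `x` comes from `S.X₂` and `δ x = 0`. -/
lemma postcomp_injective_of_shortExact {S S' : ShortComplex C} (hS : S.ShortExact)
    (hS' : S'.ShortExact) (φ : S ⟶ S') (L : C) (n : ℕ) [Subsingleton (Ext L S.X₂ (n + 1))]
    (h : ∀ x : Ext L S.X₃ n, (∃ y : Ext L S'.X₂ n, x.comp (mk₀ φ.τ₃) (add_zero n) =
      y.comp (mk₀ S'.g) (add_zero n)) → ∃ y : Ext L S.X₂ n, x = y.comp (mk₀ S.g) (add_zero n)) :
    Function.Injective ((mk₀ φ.τ₁).postcomp L (add_zero (n + 1))) := by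
  rw [injective_iff_map_eq_zero]
  intro z hz
  obtain ⟨x, rfl⟩ := covariant_sequence_exact₁ L hS z (Subsingleton.elim _ _) rfl
  have h0 : (x.comp (mk₀ φ.τ₃) (add_zero n)).comp hS'.extClass rfl = 0 := by
    refine Eq.trans ?_ (show (x.comp hS.extClass rfl).comp (mk₀ φ.τ₁) (add_zero (n + 1)) = 0 from hz)
    simp only [comp_assoc_of_second_deg_zero, comp_assoc_of_third_deg_zero,
      ShortComplex.ShortExact.extClass_naturality hS hS' φ]
  obtain ⟨y, hy⟩ := covariant_sequence_exact₃ L hS' _ rfl h0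
  obtain ⟨y', rfl⟩ := h x ⟨y, hy.symm⟩
  simp only [comp_assoc_of_second_deg_zero, ShortComplex.ShortExact.comp_extClass, comp_zero]

lemma postcomp_surjective_of_shortExact {S S' : ShortComplex C} (hS : S.ShortExact)
    (hS' : S'.ShortExact) (φ : S ⟶ S') (L : C) (n : ℕ) [Subsingleton (Ext L S'.X₂ (n + 1))]
    (h : ∀ x' : Ext L S'.X₃ n, ∃ (x : Ext L S.X₃ n) (y : Ext L S'.X₂ n),
      x' = x.comp (mk₀ φ.τ₃) (add_zero n) + y.comp (mk₀ S'.g) (add_zero n)) :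
    Function.Surjective ((mk₀ φ.τ₁).postcomp L (add_zero (n + 1))) := by
  intro z
  obtain ⟨x', rfl⟩ := covariant_sequence_exact₁ L hS' z (Subsingleton.elim _ _) rfl
  obtain ⟨x, y, rfl⟩ := h x'
  refine ⟨x.comp hS.extClass rfl, ?_⟩
  change (x.comp hS.extClass rfl).comp (mk₀ φ.τ₁) (add_zero (n + 1)) = _
  simp only [comp_assoc_of_second_deg_zero, comp_assoc_of_third_deg_zero,
    ShortComplex.ShortExact.extClass_naturality hS hS' φ, add_comp,
    ShortComplex.ShortExact.comp_extClass, comp_zero, add_zero]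

end CategoryTheory.Abelian.Ext

/-! ### From Čech cohomology to sheaf cohomology -/

namespace AltCech

open TopologicalSpace Opposite

section

variable {X : TopCat.{u}} {ι : Type*} [LinearOrder ι] {W : Opens X} {V : ι → Opens X}
variable {F G : (Opens X)ᵒᵖ ⥤ AddCommGrpCat.{u}}

/-- The cochain `c` satisfies the cocycle condition in degree `k`. -/
def IsClosed (k : ℕ) (c : Cochain F W V) : Prop := ∀ t, t.card = k + 1 → d c t = 0

/-- Two cochains agree in degree `k`. -/
def EqDeg (k : ℕ) (c c' : Cochain F W V) : Prop := ∀ t, t.card = k → c t = c' t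

lemma EqDeg.refl (k : ℕ) (c : Cochain F W V) : EqDeg k c c := fun _ _ => rfl

lemma EqDeg.symm {k : ℕ} {c c' : Cochain F W V} (h : EqDeg k c c') : EqDeg k c' c :=
  fun t ht => (h t ht).symm

lemma EqDeg.trans {k : ℕ} {c c' c'' : Cochain F W V} (h : EqDeg k c c') (h' : EqDeg k c' c'') :
    EqDeg k c c'' :=
  fun t ht => (h t ht).trans (h' t ht)

lemma EqDeg.d {k : ℕ} {c c' : Cochain F W V} (h : EqDeg k c c') : EqDeg (k + 1) (d c) (d c') :=
  fun t ht => d_congr fun i hi => h _ (by rw [Finset.card_erase_of_mem hi, ht]; rfl)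

lemma EqDeg.map {k : ℕ} {c c' : Cochain F W V} (h : EqDeg k c c') (f : F ⟶ G) :
    EqDeg k (map f c) (map f c') :=
  fun t ht => congrArg (f.app _).hom (h t ht)

lemma EqDeg.add {k : ℕ} {a b a' b' : Cochain F W V} (h : EqDeg k a b) (h' : EqDeg k a' b') :
    EqDeg k (a + a') (b + b') :=
  fun t ht => congrArg₂ (· + ·) (h t ht) (h' t ht)

lemma EqDeg.sub {k : ℕ} {a b a' b' : Cochain F W V} (h : EqDeg k a b) (h' : EqDeg k a' b') :
    EqDeg k (a - a') (b - b') :=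
  fun t ht => congrArg₂ (· - ·) (h t ht) (h' t ht)

lemma isClosed_iff {k : ℕ} {c : Cochain F W V} : IsClosed k c ↔ EqDeg (k + 1) (d c) 0 := Iff.rfl

lemma isClosed_d (k : ℕ) (c : Cochain F W V) : IsClosed k (d c) := fun t _ => by rw [d_d]; rfl

lemma map_zero' (f : F ⟶ G) : map f (0 : Cochain F W V) = 0 :=
  funext fun _ => _root_.map_zero (f.app _).hom

lemma IsClosed.map {k : ℕ} {c : Cochain F W V} (h : IsClosed k c) (f : F ⟶ G) :
    IsClosed k (map f c) := by
  have := EqDeg.map (isClosed_iff.1 h) f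
  rwa [map_d, map_zero'] at this

lemma Exact.exists_of_isClosed (hF : Exact F W V) {k : ℕ} {c : Cochain F W V}
    (hc : IsClosed k c) : ∃ u, EqDeg k c (AltCech.d u) := by
  -- `Exact` treats all degrees together, so `c` is first cut off outside degree `k`.
  obtain ⟨u, hu⟩ := hF (fun t => if t.card = k then c t else 0) (by
    funext t
    by_cases ht : t.card = k + 1
    · rw [Pi.zero_apply, ← hc t ht]
      exact d_congr fun i hi => if_pos (by rw [Finset.card_erase_of_mem hi, ht]; rfl)
    · refine d_eq_zero fun i hi => if_neg fun h => ht ?_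
      rw [← h, Finset.card_erase_add_one hi])
  exact ⟨u, fun t ht => by rw [hu]; exact (if_pos ht).symm⟩

lemma exists_cochain {k : ℕ} {P : ∀ t, F.obj (op (inter W V t)) → Prop}
    (h : ∀ t, t.card = k → ∃ x, P t x) : ∃ c : Cochain F W V, ∀ t, t.card = k → P t (c t) := by
  have : ∀ t, ∃ x, t.card = k → P t x := fun t => by
    by_cases ht : t.card = k
    · obtain ⟨x, hx⟩ := h t ht
      exact ⟨x, fun _ => hx⟩
    · exact ⟨0, fun h => absurd h ht⟩
  choose c hc using this
  exact ⟨c, hc⟩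

variable (W V) in
/-- The map induced by `f` on the Čech cohomology at the cochains of degree `k` is injective. -/
def CechInjective (f : F ⟶ G) (k : ℕ) : Prop :=
  ∀ c : Cochain F W V, IsClosed k c → (∃ u, EqDeg k (map f c) (d u)) → ∃ u, EqDeg k c (d u)

variable (W V) in
/-- The map induced by `f` on the Čech cohomology at the cochains of degree `k` is surjective. -/
def CechSurjective (f : F ⟶ G) (k : ℕ) : Prop :=
  ∀ c' : Cochain G W V, IsClosed k c' →
    ∃ c : Cochain F W V, IsClosed k c ∧ ∃ u, EqDeg k c' (map f c + d u)

end

section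

variable {X : TopCat.{u}} {ι : Type*} [LinearOrder ι] {W : Opens X} {V : ι → Opens X}
variable {S S' : ShortComplex (Sheaf (Opens.grothendieckTopology X) AddCommGrpCat.{u})}

lemma exists_map_f_eqDeg (hS : S.ShortExact) {k : ℕ} {b : Cochain S.X₂.obj W V}
    (hb : EqDeg k (map S.g.hom b) 0) : ∃ a : Cochain S.X₁.obj W V, EqDeg k (map S.f.hom a) b :=
  exists_cochain fun t ht => exists_of_app_g_eq_zero hS (b t) (hb t ht)

lemma eqDeg_of_map_f (hS : S.ShortExact) {k : ℕ} {a a' : Cochain S.X₁.obj W V}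
    (h : EqDeg k (map S.f.hom a) (map S.f.hom a')) : EqDeg k a a' :=
  fun t ht => app_injective hS _ (h t ht)

lemma exists_map_g_eqDeg {k : ℕ}
    (hg : ∀ s : Finset ι, s.card = k → Function.Surjective (S.g.hom.app (op (inter W V s))).hom)
    (c : Cochain S.X₃.obj W V) : ∃ b : Cochain S.X₂.obj W V, EqDeg k (map S.g.hom b) c :=
  exists_cochain fun t ht => hg t ht (c t)

lemma map_map_comm (φ : S ⟶ S') (c : Cochain S.X₁.obj W V) :
    map S'.f.hom (map φ.τ₁.hom c) = map φ.τ₂.hom (map S.f.hom c) :=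
  funext fun t => congrArg (fun ψ => (ψ.hom.app (op (inter W V t))).hom (c t)) φ.comm₁₂

lemma map_map_comm' (φ : S ⟶ S') (c : Cochain S.X₂.obj W V) :
    map S'.g.hom (map φ.τ₂.hom c) = map φ.τ₃.hom (map S.g.hom c) :=
  funext fun t => congrArg (fun ψ => (ψ.hom.app (op (inter W V t))).hom (c t)) φ.comm₂₃

/-- The cocycles of `S.X₃` of degree `k` that become cocycles of `S'.X₂` come from `S.X₂`. -/
lemma exists_of_cechInjective (hS : S.ShortExact) (hS' : S'.ShortExact) (φ : S ⟶ S') {k : ℕ}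
    (hg : ∀ s : Finset ι, s.card = k → Function.Surjective (S.g.hom.app (op (inter W V s))).hom)
    (h : CechInjective W V φ.τ₁.hom (k + 1)) (c : Cochain S.X₃.obj W V) (hc : IsClosed k c)
    (b' : Cochain S'.X₂.obj W V) (hb' : IsClosed k b')
    (hcb : EqDeg k (map φ.τ₃.hom c) (map S'.g.hom b')) :
    ∃ b : Cochain S.X₂.obj W V, IsClosed k b ∧ EqDeg k c (map S.g.hom b) := by
  obtain ⟨b, hb⟩ := exists_map_g_eqDeg hg c
  have hdb : EqDeg (k + 1) (map S.g.hom (d b)) 0 := by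
    rw [map_d]; exact hb.d.trans hc
  obtain ⟨a, ha⟩ := exists_map_f_eqDeg hS hdb
  have hac : IsClosed (k + 1) a := isClosed_iff.2 (eqDeg_of_map_f hS <| by
    rw [map_d, map_zero']; exact ha.d.trans (by rw [d_d]; exact fun _ _ => rfl))
  have he : EqDeg k (map S'.g.hom (map φ.τ₂.hom b - b')) 0 := by
    rw [map_sub, map_map_comm']
    have := ((hb.map φ.τ₃.hom).trans hcb).sub (EqDeg.refl k (map S'.g.hom b'))
    rwa [sub_self] at this
  obtain ⟨a', ha'⟩ := exists_map_f_eqDeg hS' he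
  -- As `b'` is closed, `a'` bounds the image of `a`. Injectivity then gives `a = d a''`, and `b - f
  -- a''` is the closed lift.
  have haa : EqDeg (k + 1) (map φ.τ₁.hom a) (d a') := by
    refine eqDeg_of_map_f hS' ?_
    rw [map_map_comm]
    refine (ha.map φ.τ₂.hom).trans ?_
    rw [map_d, map_d]
    refine EqDeg.trans ?_ ha'.d.symm
    rw [d_sub]
    have := (EqDeg.refl (k + 1) (d (map φ.τ₂.hom b))).sub (isClosed_iff.1 hb')
    rw [sub_zero] at this
    exact this.symm
  obtain ⟨a'', ha''⟩ := h a hac ⟨a', haa⟩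
  refine ⟨b - map S.f.hom a'', ?_, ?_⟩
  · rw [isClosed_iff, d_sub, ← map_d]
    have := ha.symm.sub (ha''.map S.f.hom).symm
    rwa [sub_self] at this
  · rw [map_sub, map_g_map_f, sub_zero]
    exact hb.symm

/-- Lift `c'` to `b'` with `d b' = f' a'`, and write `a' = φ.τ₁ a + d u`. Exactness of `S.X₂` gives
`f a = d b`; then `g b` is the required cocycle and `b' - φ.τ₂ b - f' u` the closed remainder. -/
lemma exists_of_cechSurjective (hS' : S'.ShortExact) (φ : S ⟶ S') {k : ℕ}
    (hg : ∀ s : Finset ι, s.card = k → Function.Surjective (S'.g.hom.app (op (inter W V s))).hom)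
    (h₂ : Exact S.X₂.obj W V) (h : CechSurjective W V φ.τ₁.hom (k + 1))
    (c' : Cochain S'.X₃.obj W V) (hc' : IsClosed k c') :
    ∃ c : Cochain S.X₃.obj W V, IsClosed k c ∧ ∃ b' : Cochain S'.X₂.obj W V, IsClosed k b' ∧
      EqDeg k c' (map φ.τ₃.hom c + map S'.g.hom b') := by
  obtain ⟨b', hb'⟩ := exists_map_g_eqDeg hg c'
  have hdb : EqDeg (k + 1) (map S'.g.hom (d b')) 0 := by
    rw [map_d]; exact hb'.d.trans hc'
  obtain ⟨a', ha'⟩ := exists_map_f_eqDeg hS' hdb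
  have hac : IsClosed (k + 1) a' := isClosed_iff.2 (eqDeg_of_map_f hS' <| by
    rw [map_d, map_zero']; exact ha'.d.trans (by rw [d_d]; exact fun _ _ => rfl))
  obtain ⟨a, ha, u, hu⟩ := h a' hac
  obtain ⟨b, hb⟩ := h₂.exists_of_isClosed (ha.map S.f.hom)
  refine ⟨map S.g.hom b, ?_, b' - map φ.τ₂.hom b - map S'.f.hom u, ?_, ?_⟩
  · rw [isClosed_iff, ← map_d]
    refine (hb.symm.map S.g.hom).trans ?_
    rw [map_g_map_f]
    exact fun _ _ => rfl
  · rw [isClosed_iff, d_sub, d_sub, ← map_d, ← map_d]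
    have := (ha'.symm.sub (hb.symm.map φ.τ₂.hom)).sub
      (EqDeg.refl (k + 1) (map S'.f.hom (d u)))
    refine this.trans ?_
    have := hu.map S'.f.hom
    rw [map_add, map_map_comm] at this
    intro t ht
    have e := this t ht
    simp only [Pi.sub_apply, Pi.add_apply, Pi.zero_apply] at e ⊢
    rw [e]; abel
  · rw [map_sub, map_sub, map_g_map_f, map_map_comm', sub_zero, add_sub_cancel]
    exact hb'.symm

/-- The cochain bounding the image of `c` has to be lifted as well, whence the second surjectivity
assumption, in degree `k`. -/
lemma cechInjective_of_shortExact (hS : S.ShortExact) (hS' : S'.ShortExact) (φ : S ⟶ S') {k : ℕ}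
    (hg : ∀ s : Finset ι, s.card = k + 1 →
      Function.Surjective (S.g.hom.app (op (inter W V s))).hom)
    (hg' : ∀ s : Finset ι, s.card = k →
      Function.Surjective (S'.g.hom.app (op (inter W V s))).hom)
    (h₂ : Exact S.X₂.obj W V)
    (h : CechInjective W V φ.τ₁.hom (k + 2)) : CechInjective W V φ.τ₃.hom (k + 1) := by
  rintro c hc ⟨u', hu'⟩
  obtain ⟨v', hv'⟩ := exists_map_g_eqDeg hg' u'
  obtain ⟨b, hb, hcb⟩ := exists_of_cechInjective hS hS' φ hg h c hc (d v') (isClosed_d _ _) (by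
    rw [map_d]; exact hu'.trans hv'.symm.d)
  obtain ⟨w, hw⟩ := h₂.exists_of_isClosed hb
  refine ⟨map S.g.hom w, ?_⟩
  rw [← map_d]
  exact hcb.trans (hw.map S.g.hom)

lemma cechSurjective_of_shortExact (hS' : S'.ShortExact) (φ : S ⟶ S') {k : ℕ}
    (hg : ∀ s : Finset ι, s.card = k → Function.Surjective (S'.g.hom.app (op (inter W V s))).hom)
    (h₂ : Exact S.X₂.obj W V) (h₂' : Exact S'.X₂.obj W V)
    (h : CechSurjective W V φ.τ₁.hom (k + 1)) : CechSurjective W V φ.τ₃.hom k := by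
  intro c' hc'
  obtain ⟨c, hc, b', hb', e⟩ := exists_of_cechSurjective hS' φ hg h₂ h c' hc'
  obtain ⟨w, hw⟩ := h₂'.exists_of_isClosed hb'
  refine ⟨c, hc, map S'.g.hom w, e.trans ?_⟩
  rw [← map_d]
  exact (EqDeg.refl _ _).add (hw.map S'.g.hom)

end

/-- Cocycles of degree one glue. -/
lemma exists_eqDeg_d_const {X : TopCat.{u}} {ι : Type*} [LinearOrder ι] {W : Opens X}
    {V : ι → Opens X} (A : Sheaf (Opens.grothendieckTopology X) AddCommGrpCat.{u})
    (hW : W ≤ ⨆ i, V i) (hV : ∀ i, V i ≤ W) (c : Cochain A.obj W V) (hc : IsClosed 1 c) :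
    ∃ x, EqDeg 1 c (d (const V x)) := by
  -- In an injective sheaf containing `A` the cocycle is the coboundary of a global section; that
  -- section is locally in `A`, hence in `A`.
  let S := ShortComplex.mk (Injective.ι A) (Limits.cokernel.π (Injective.ι A)) (by simp)
  have hS : S.ShortExact := { exact := ShortComplex.exact_cokernel _ }
  obtain ⟨w, hw⟩ := (exact_of_injective (Injective.under A) hW).exists_of_isClosed
    (hc.map S.f.hom)
  have hw0 : (S.g.hom.app (op W)).hom (res _ (inter_empty W V).ge (w ∅)) = 0 := by
    rw [app_res]
    refine eq_of_d_singleton_eq S.X₃ hW hV (map S.g.hom w) 0 fun i => ?_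
    rw [← map_d, _root_.map_zero]
    have := (hw.map S.g.hom).symm {i} (Finset.card_singleton i)
    rw [map_g_map_f] at this
    exact this
  obtain ⟨x, hx⟩ := exists_of_app_g_eq_zero hS _ hw0
  refine ⟨x, eqDeg_of_map_f hS (hw.trans fun t ht => ?_)⟩
  obtain ⟨i, rfl⟩ := Finset.card_eq_one.1 ht
  rw [map_d, d_singleton, d_singleton]
  change _ = res _ _ ((S.f.hom.app _).hom (res _ _ x))
  rw [app_res, hx, res_res, res_res]

section Comparison

variable {X : Scheme.{u}} {ι : Type*} [LinearOrder ι] {V : ι → X.Opens}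
variable {S S' : ShortComplex (Sheaf (Opens.grothendieckTopology X) AddCommGrpCat.{u})}

lemma map_const {X : TopCat.{u}} {W : Opens X} {V : ι → Opens X}
    {F G : (Opens X)ᵒᵖ ⥤ AddCommGrpCat.{u}} (f : F ⟶ G) (x : F.obj (op W)) :
    map f (const V x) = const V ((f.app (op W)).hom x) :=
  funext fun _ => app_res _ _ _

lemma eq_of_eqDeg_d_const {X : TopCat.{u}} {V : ι → Opens X}
    (A : Sheaf (Opens.grothendieckTopology X) AddCommGrpCat.{u})
    (hV : ⨆ i, V i = ⊤) {x y : A.obj.obj (op ⊤)}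
    (h : EqDeg 1 (d (const V x)) (d (const V y))) : x = y := by
  have := eq_of_d_singleton_eq A hV.ge (fun i => le_top) (const V x) y fun i => by
    rw [h {i} (Finset.card_singleton i), d_const_singleton]
  rwa [const, res_res, res_self] at this

open Sheaf Abelian

section

variable {X : TopCat.{u}} {V : ι → Opens X}
variable {S S' : ShortComplex (Sheaf (Opens.grothendieckTopology X) AddCommGrpCat.{u})}

/-- Degree zero cohomology is given by the global sections. -/
noncomputable def globalSections (F : Sheaf (Opens.grothendieckTopology X) AddCommGrpCat.{u}) :
    H.{u} F 0 ≃+ F.obj.obj (op (⊤ : Opens X)) := H.equiv₀ F Limits.isTerminalTop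

lemma globalSections_comp {F G : Sheaf (Opens.grothendieckTopology X) AddCommGrpCat.{u}}
    (ψ : F ⟶ G) (x : H.{u} F 0) : globalSections G (x.comp (Ext.mk₀ ψ) (add_zero 0)) =
      (ψ.hom.app (op ⊤)).hom (globalSections F x) :=
  (H.equiv₀_naturality Limits.isTerminalTop ψ x).symm

/-- Degree-zero cochains live on the whole space, where `S.g` need not be surjective on sections. So
global sections are compared directly, through their cocycles `d (const V x)`. -/
lemma injective_H_one_map (hS : S.ShortExact) (hS' : S'.ShortExact) (φ : S ⟶ S')
    [Injective S.X₂] (hV : ⨆ i, V i = ⊤)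
    (hg : ∀ s : Finset ι, s.card = 1 →
      Function.Surjective (S.g.hom.app (op (inter (⊤ : Opens X) V s))).hom)
    (h : CechInjective (⊤ : Opens X) V φ.τ₁.hom 2) :
    Function.Injective (H.map.{u} φ.τ₁ 1) := by
  refine Ext.postcomp_injective_of_shortExact hS hS' φ _ 0 fun x ⟨y, hy⟩ => ?_
  have hxy := congrArg (globalSections S'.X₃) hy
  rw [globalSections_comp, globalSections_comp] at hxy
  obtain ⟨b, hb, hxb⟩ := exists_of_cechInjective hS hS' φ hg h
    (d (const V (globalSections _ x))) (isClosed_d _ _) (d (const V (globalSections _ y)))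
    (isClosed_d _ _) (by
      rw [map_d, map_const, hxy, map_d, map_const]; exact EqDeg.refl _ _)
  obtain ⟨z, hz⟩ := exists_eqDeg_d_const S.X₂ hV.ge (fun i => le_top) b hb
  refine ⟨(globalSections _).symm z, (globalSections _).injective ?_⟩
  rw [globalSections_comp, AddEquiv.apply_symm_apply]
  refine eq_of_eqDeg_d_const _ hV (hxb.trans ?_)
  rw [← map_const, ← map_d]
  exact hz.map _

lemma surjective_H_one_map (hS : S.ShortExact) (hS' : S'.ShortExact) (φ : S ⟶ S')
    [Injective S.X₂] [Injective S'.X₂] (hV : ⨆ i, V i = ⊤)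
    (hg : ∀ s : Finset ι, s.card = 1 →
      Function.Surjective (S'.g.hom.app (op (inter (⊤ : Opens X) V s))).hom)
    (h : CechSurjective (⊤ : Opens X) V φ.τ₁.hom 2) :
    Function.Surjective (H.map.{u} φ.τ₁ 1) := by
  refine Ext.postcomp_surjective_of_shortExact hS hS' φ _ 0 fun x' => ?_
  obtain ⟨c, hc, b', hb', h⟩ := exists_of_cechSurjective hS' φ hg (exact_of_injective S.X₂ hV.ge) h
    (d (const V (globalSections _ x'))) (isClosed_d _ _)
  obtain ⟨x, hx⟩ := exists_eqDeg_d_const S.X₃ hV.ge (fun i => le_top) c hc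
  obtain ⟨y, hy⟩ := exists_eqDeg_d_const S'.X₂ hV.ge (fun i => le_top) b' hb'
  refine ⟨(globalSections _).symm x, (globalSections _).symm y, (globalSections _).injective ?_⟩
  rw [_root_.map_add, globalSections_comp, globalSections_comp, AddEquiv.apply_symm_apply,
    AddEquiv.apply_symm_apply]
  refine eq_of_eqDeg_d_const _ hV (h.trans ?_)
  refine ((hx.map φ.τ₃.hom).add (hy.map S'.g.hom)).trans ?_
  rw [map_d, map_d, map_const, map_const, ← d_add]
  refine EqDeg.d (k := 0) fun t _ => ?_
  exact (_root_.map_add (res _ _) _ _).symm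

/-- Positive cohomology of injective sheaves vanishes, so the connecting maps from degree `n + 1` to
degree `n + 2` are isomorphisms. -/
lemma bijective_H_add_two_map (hS : S.ShortExact) (hS' : S'.ShortExact) (φ : S ⟶ S')
    [Injective S.X₂] [Injective S'.X₂] (n : ℕ)
    (h : Function.Bijective (H.map.{u} φ.τ₃ (n + 1))) :
    Function.Bijective (H.map.{u} φ.τ₁ (n + 1 + 1)) := by
  constructor
  · refine Ext.postcomp_injective_of_shortExact hS hS' φ _ (n + 1) fun x ⟨y, hy⟩ => ⟨0, ?_⟩
    have hy0 : y = 0 := Subsingleton.elim _ _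
    rw [Ext.zero_comp]
    refine h.1 (Eq.trans ?_ (_root_.map_zero _).symm)
    rw [hy0, Ext.zero_comp] at hy
    exact hy
  · refine Ext.postcomp_surjective_of_shortExact hS hS' φ _ (n + 1) fun x' => ?_
    obtain ⟨x, hx⟩ := h.2 x'
    refine ⟨x, 0, ?_⟩
    rw [Ext.zero_comp, add_zero]
    exact hx.symm

end

lemma exists_shortExact_injective {X : TopCat.{u}}
    {A A' : Sheaf (Opens.grothendieckTopology X) AddCommGrpCat.{u}} (f : A ⟶ A') :
    ∃ (I I' Q Q' : Sheaf (Opens.grothendieckTopology X) AddCommGrpCat.{u})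
      (i : A ⟶ I) (g : I ⟶ Q) (w : i ≫ g = 0) (i' : A' ⟶ I') (g' : I' ⟶ Q') (w' : i' ≫ g' = 0)
      (φ : ShortComplex.mk i g w ⟶ ShortComplex.mk i' g' w'), Injective I ∧ Injective I' ∧
        (ShortComplex.mk i g w).ShortExact ∧ (ShortComplex.mk i' g' w').ShortExact ∧ φ.τ₁ = f := by
  have hf : Injective.ι A ≫ Injective.factorThru (f ≫ Injective.ι A') (Injective.ι A) =
      f ≫ Injective.ι A' := Injective.comp_factorThru _ _
  exact ⟨Injective.under A, Injective.under A', _, _, Injective.ι A,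
    Limits.cokernel.π (Injective.ι A), by simp, Injective.ι A', Limits.cokernel.π (Injective.ι A'),
    by simp,
    { τ₁ := f
      τ₂ := Injective.factorThru (f ≫ Injective.ι A') (Injective.ι A)
      τ₃ := Limits.cokernel.map _ _ f _ hf
      comm₁₂ := hf.symm
      comm₂₃ := (Limits.cokernel.π_desc _ _ _).symm }, inferInstance, inferInstance,
    { exact := ShortComplex.exact_cokernel _ }, { exact := ShortComplex.exact_cokernel _ }, rfl⟩

/-- Morphisms inducing bijections on Čech cohomology for a covering with affine intersections
induce bijections on sheaf cohomology. -/
theorem bijective_H_map (hV : ⨆ i, V i = ⊤)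
    (haff : ∀ s : Finset ι, s.Nonempty → IsAffineOpen (inter (⊤ : X.Opens) V s)) (n : ℕ) :
    ∀ {A A' : Sheaf (Opens.grothendieckTopology X) AddCommGrpCat.{u}} (f : A ⟶ A'),
    AffineExact A → AffineExact A' → CechInjective (⊤ : X.Opens) V f.hom (n + 2) →
    CechSurjective (⊤ : X.Opens) V f.hom (n + 2) →
    Function.Bijective (H.map.{u} f (n + 1)) := by
  -- Only nonempty intersections are affine, so the degree is written `k + 1`.
  have surj : ∀ {S : ShortComplex (Sheaf (Opens.grothendieckTopology X) AddCommGrpCat.{u})}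
      (_ : S.ShortExact) (_ : AffineExact S.X₁) (_ : Injective S.X₂) (k : ℕ) (s : Finset ι),
      s.card = k + 1 →
      Function.Surjective (S.g.hom.app (op (inter (⊤ : X.Opens) V s))).hom :=
    fun hS hA _ k s hs =>
      AffineExact.app_surjective hS hA (haff s (Finset.card_pos.1 (by omega)))
  induction n with
  | zero =>
    intro A A' f hA hA' hinj hsurj
    obtain ⟨I, I', Q, Q', i, g, w, i', g', w', φ, hI, hI', hS, hS', rfl⟩ :=
      exists_shortExact_injective f
    exact ⟨injective_H_one_map hS hS' φ hV (surj hS hA hI 0) hinj,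
      surjective_H_one_map hS hS' φ hV (surj hS' hA' hI' 0) hsurj⟩
  | succ n ih =>
    intro A A' f hA hA' hinj hsurj
    obtain ⟨I, I', Q, Q', i, g, w, i', g', w', φ, hI, hI', hS, hS', rfl⟩ :=
      exists_shortExact_injective f
    have hIe : Exact I.obj (⊤ : X.Opens) V := exact_of_injective I hV.ge
    have hIe' : Exact I'.obj (⊤ : X.Opens) V := exact_of_injective I' hV.ge
    -- Passing to the cokernels lowers both degrees by one: cohomology from `n + 2` to `n + 1`, Čech
    -- cochains from `n + 3` to `n + 2`.
    exact bijective_H_add_two_map hS hS' φ n <|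
      ih φ.τ₃ (AffineExact.of_shortExact hS hA) (AffineExact.of_shortExact hS' hA')
      (cechInjective_of_shortExact hS hS' φ (surj hS hA hI _) (surj hS' hA' hI' _) hIe hinj)
      (cechSurjective_of_shortExact hS' φ (surj hS' hA' hI' _) hIe hIe' hsurj)

end Comparison

end AltCech

/-! ### Laurent polynomials -/

/-- The ring of Laurent polynomials in the variables `x_i`, `i : ι`. -/
abbrev Laurent (L ι : Type*) [Semiring L] : Type _ := AddMonoidAlgebra L (ι → ℤ)

namespace Laurent

open AddMonoidAlgebra

variable {L ι : Type*} [Field L]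

/-- The exponent of a monomial, as an exponent of a Laurent monomial. -/
def expHom (ι : Type*) : (ι →₀ ℕ) →+ (ι → ℤ) where
  toFun a i := a i
  map_zero' := by ext; simp
  map_add' a b := by ext; simp

@[simp] lemma expHom_apply (a : ι →₀ ℕ) (i : ι) : expHom ι a i = a i := rfl

lemma expHom_injective : Function.Injective (expHom ι) := fun a b h => by
  ext i; exact Nat.cast_injective (R := ℤ) (congrFun h i)

/-- The inclusion of polynomials into Laurent polynomials. -/
noncomputable def ofPoly : MvPolynomial ι L →ₐ[L] Laurent L ι :=
  AddMonoidAlgebra.mapDomainAlgHom L L (expHom ι)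

lemma coeff_ofPoly_expHom (g : MvPolynomial ι L) (a : ι →₀ ℕ) :
    (ofPoly g).coeff (expHom ι a) = g.coeff a :=
  Finsupp.mapDomain_apply expHom_injective _ _

lemma coeff_ofPoly_of_neg (g : MvPolynomial ι L) {a : ι → ℤ} {i : ι} (h : a i < 0) :
    (ofPoly g).coeff a = 0 :=
  Finsupp.mapDomain_of_notMem_range _ _ (by rintro ⟨b, rfl⟩; simp at h; omega)

lemma ofPoly_injective : Function.Injective (ofPoly : MvPolynomial ι L →ₐ[L] Laurent L ι) :=
  fun f g h => by
    ext a; rw [← coeff_ofPoly_expHom, h, coeff_ofPoly_expHom]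

lemma ofPoly_monomial (a : ι →₀ ℕ) (c : L) :
    ofPoly (MvPolynomial.monomial a c) = single (expHom ι a) c :=
  AddMonoidAlgebra.mapDomain_single

lemma exists_of_coeff_ofPoly_ne_zero {g : MvPolynomial ι L} {a : ι → ℤ}
    (h : (ofPoly g).coeff a ≠ 0) : ∃ b, a = expHom ι b ∧ g.coeff b ≠ 0 := by
  have h0 : ∀ i, 0 ≤ a i := fun i => by
    by_contra hi
    exact h (coeff_ofPoly_of_neg g (not_le.1 hi))
  by_contra! H
  refine h (Finsupp.mapDomain_of_notMem_range _ _ ?_)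
  rintro ⟨b, rfl⟩
  exact h ((coeff_ofPoly_expHom g b).trans (H b rfl))

instance (p : ℕ) [CharP L p] : CharP (Laurent L ι) p :=
  charP_of_injective_algebraMap (algebraMap L (Laurent L ι)).injective p

lemma exists_mem_support_add {f g : Laurent L ι} {a : ι → ℤ} (h : (f * g).coeff a ≠ 0) :
    ∃ b c, f.coeff b ≠ 0 ∧ g.coeff c ≠ 0 ∧ b + c = a := by
  classical
  have := support_coeff_mul_subset f g (Finsupp.mem_support_iff.2 h)
  obtain ⟨b, hb, c, hc, rfl⟩ := Finset.mem_add.1 this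
  exact ⟨b, c, Finsupp.mem_support_iff.1 hb, Finsupp.mem_support_iff.1 hc, rfl⟩

section Frobenius

variable (p : ℕ) [Fact p.Prime] [CharP L p]

/-- Additivity of Frobenius reduces this to a single monomial. -/
lemma coeff_pow_smul (f : Laurent L ι) (v : ι → ℤ) :
    (f ^ p).coeff (p • v) = f.coeff v ^ p := by
  classical
  have hp : p ≠ 0 := (Fact.out : p.Prime).ne_zero
  induction f using AddMonoidAlgebra.induction_linear with
  | zero => simp [zero_pow hp]
  | add f g hf hg => rw [add_pow_char, coeff_add, Finsupp.add_apply, hf, hg, coeff_add,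
      Finsupp.add_apply, add_pow_char]
  | single a c =>
    rw [single_pow, coeff_single, coeff_single, Finsupp.single_apply, Finsupp.single_apply]
    have : p • a = p • v ↔ a = v := smul_right_injective _ hp |>.eq_iff
    simp only [this]
    split_ifs
    · rfl
    · rw [zero_pow hp]

lemma exists_of_coeff_pow_ne_zero {f : Laurent L ι} {a : ι → ℤ} (h : (f ^ p).coeff a ≠ 0) :
    ∃ v, a = p • v := by
  classical
  have hp : p ≠ 0 := (Fact.out : p.Prime).ne_zero
  contrapose! h
  induction f using AddMonoidAlgebra.induction_linear with
  | zero => simp [zero_pow hp]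
  | add f g hf hg => rw [add_pow_char, coeff_add, Finsupp.add_apply, hf, hg, add_zero]
  | single b c =>
    rw [single_pow, coeff_single, Finsupp.single_apply, if_neg fun e => h b e.symm]

end Frobenius

/-! ### Graded pieces of the localizations of the polynomial ring at products of variables -/

section Piece

variable [Fintype ι]

/-- The elements of degree `e` of the localization of the polynomial ring at `∏ i ∈ s, x_i`. -/
def piece (L : Type*) [Field L] (s : Finset ι) (e : ℤ) : AddSubgroup (Laurent L ι) where
  carrier := {f | ∀ a, f.coeff a ≠ 0 → (∀ i ∉ s, 0 ≤ a i) ∧ ∑ i, a i = e}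
  zero_mem' a h := absurd (by simp) h
  add_mem' {f g} hf hg a h := by
    by_cases h' : f.coeff a = 0
    · exact hg a fun h'' => h (by simp [h', h''])
    · exact hf a h'
  neg_mem' {f} hf a h := hf a fun h' => h (by simp [h'])

lemma piece_mono {s t : Finset ι} (h : s ⊆ t) (e : ℤ) : piece L s e ≤ piece L t e :=
  fun _ hf a ha => ⟨fun i hi => (hf a ha).1 i fun hi' => hi (h hi'), (hf a ha).2⟩

lemma mul_mem_piece {s : Finset ι} {e e' : ℤ} {f g : Laurent L ι} (hf : f ∈ piece L s e)
    (hg : g ∈ piece L s e') : f * g ∈ piece L s (e + e') := by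
  intro a ha
  obtain ⟨b, c, hb, hc, rfl⟩ := exists_mem_support_add ha
  refine ⟨fun i hi => add_nonneg ((hf b hb).1 i hi) ((hg c hc).1 i hi), ?_⟩
  rw [← (hf b hb).2, ← (hg c hc).2, ← Finset.sum_add_distrib]
  rfl

lemma single_mem_piece {s : Finset ι} {a : ι → ℤ} (h : ∀ i ∉ s, 0 ≤ a i) (c : L) :
    single a c ∈ piece L s (∑ i, a i) := by
  classical
  intro b hb
  rw [coeff_single, Finsupp.single_apply] at hb
  obtain rfl : a = b := by by_contra h'; simp [h'] at hb
  exact ⟨h, rfl⟩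

lemma one_mem_piece (s : Finset ι) : (1 : Laurent L ι) ∈ piece L s 0 := by
  have := single_mem_piece (s := s) (a := 0) (by simp) (1 : L)
  rwa [show ∑ i, (0 : ι → ℤ) i = 0 by simp] at this

lemma pow_mem_piece {s : Finset ι} {e : ℤ} {f : Laurent L ι} (hf : f ∈ piece L s e) (n : ℕ) :
    f ^ n ∈ piece L s (n * e) := by
  induction n with
  | zero => simpa using one_mem_piece s
  | succ n ih =>
    rw [pow_succ]
    rw [show ((n + 1 : ℕ) : ℤ) * e = n * e + e by push_cast; ring]
    exact mul_mem_piece ih hf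

lemma ofPoly_mem_piece {g : MvPolynomial ι L} {n : ℕ} (hg : g.IsHomogeneous n) (s : Finset ι) :
    ofPoly g ∈ piece L s n := by
  intro a ha
  obtain ⟨b, rfl, hb⟩ := exists_of_coeff_ofPoly_ne_zero ha
  refine ⟨fun i _ => by simp, ?_⟩
  rw [← hg hb, Finsupp.weight_apply, Finsupp.sum_fintype _ _ (by simp)]
  simp

/-- The exponent of `∏ i ∈ s, x_i`. -/
noncomputable def expInd (s : Finset ι) : ι → ℤ := by
  classical
  exact fun i => if i ∈ s then 1 else 0

lemma sum_expInd (s : Finset ι) : ∑ i, expInd s i = s.card := by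
  classical
  simp [expInd]

/-- The Laurent monomial `(∏ i ∈ s, x_i) ^ n`. -/
noncomputable def prodPow (L : Type*) [Field L] (s : Finset ι) (n : ℤ) : Laurent L ι :=
  single (n • expInd s) 1

lemma prodPow_add (s : Finset ι) (m n : ℤ) :
    prodPow L s (m + n) = prodPow L s m * prodPow L s n := by
  simp [prodPow, single_mul_single, add_smul]

lemma prodPow_zero (s : Finset ι) : prodPow L s 0 = 1 := by
  simp [prodPow]; rfl

lemma prodPow_neg_mul (s : Finset ι) (n : ℤ) : prodPow L s (-n) * prodPow L s n = 1 := by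
  rw [← prodPow_add, neg_add_cancel, prodPow_zero]

lemma prodPow_mul_neg (s : Finset ι) (n : ℤ) : prodPow L s n * prodPow L s (-n) = 1 := by
  rw [← prodPow_add, add_neg_cancel, prodPow_zero]

lemma prodPow_mem_piece (s : Finset ι) (n : ℤ) : prodPow L s n ∈ piece L s (n * s.card) := by
  have := single_mem_piece (s := s) (a := n • expInd s) (fun i hi => by simp [expInd, hi]) (1 : L)
  rwa [show ∑ i, (n • expInd s) i = n * s.card by
    rw [← sum_expInd, Finset.mul_sum]; rfl] at this

lemma prodPow_natCast (s : Finset ι) (n : ℕ) :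
    prodPow L s n = ofPoly ((∏ i ∈ s, MvPolynomial.X i) ^ n) := by
  classical
  have : (∏ i ∈ s, MvPolynomial.X i : MvPolynomial ι L) =
      MvPolynomial.monomial (∑ i ∈ s, Finsupp.single i 1) 1 := by
    rw [MvPolynomial.monomial_sum_one]; rfl
  rw [this, map_pow, ofPoly_monomial, single_pow, one_pow, prodPow]
  congr 1
  ext i
  simp [expInd, Finsupp.single_apply]

lemma exists_ofPoly_of_nonneg {f : Laurent L ι} (h : ∀ a, f.coeff a ≠ 0 → ∀ i, 0 ≤ a i) :
    ∃ g : MvPolynomial ι L, f = ofPoly g := by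
  have hinj := expHom_injective (ι := ι)
  refine ⟨AddMonoidAlgebra.comapDomain (expHom ι) hinj f,
    (AddMonoidAlgebra.mapDomain_comapDomain ?_ hinj).symm⟩
  intro a ha
  have h0 := h a (Finsupp.mem_support_iff.1 ha)
  refine ⟨Finsupp.equivFunOnFinite.symm fun i => (a i).toNat, ?_⟩
  ext i
  simp [h0 i]

lemma isHomogeneous_of_ofPoly_mem {g : MvPolynomial ι L} {s : Finset ι} {n : ℕ}
    (h : ofPoly g ∈ piece L s n) : g.IsHomogeneous n := by
  intro a ha
  have := (h (expHom ι a) (by rwa [coeff_ofPoly_expHom])).2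
  rw [Finsupp.weight_apply, Finsupp.sum_fintype _ _ (by simp)]
  simp at this ⊢
  exact_mod_cast this

lemma exists_prodPow_mul_eq {s : Finset ι} {e : ℤ} {f : Laurent L ι} (hf : f ∈ piece L s e) :
    ∃ m : ℕ, ∀ n : ℕ, m ≤ n → ∃ g : MvPolynomial ι L, prodPow L s n * f = ofPoly g := by
  classical
  -- This sum dominates the absolute value of every exponent occurring in `f`.
  refine ⟨∑ a ∈ f.coeff.support, ∑ i, (a i).natAbs, fun n hn => exists_ofPoly_of_nonneg ?_⟩
  intro a ha i
  rw [prodPow, coeff_single_mul_apply, one_mul] at ha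
  set b := -((n : ℤ) • expInd s) + a with hb
  have hab : a i = n * expInd s i + b i := by simp [hb]
  rw [hab]
  by_cases hi : i ∈ s
  · have h1 : (b i).natAbs ≤ n := calc
      _ ≤ ∑ i, (b i).natAbs := Finset.single_le_sum (f := fun i => (b i).natAbs)
        (fun _ _ => Nat.zero_le _) (Finset.mem_univ i)
      _ ≤ _ := Finset.single_le_sum (f := fun b : ι → ℤ => ∑ i, (b i).natAbs)
        (fun _ _ => Nat.zero_le _) (Finsupp.mem_support_iff.2 ha)
      _ ≤ n := hn
    simp only [expInd, hi, if_true]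
    omega
  · have := (hf b ha).1 i hi
    simp [expInd, hi, this]

end Piece

end Laurent

namespace Laurent

open AddMonoidAlgebra

variable {L ι : Type*} [Field L]

/-! ### Exactness of the Čech complex of the Laurent polynomials -/

section Exactness

variable [Fintype ι] [LinearOrder ι]

/-- The coefficients of `f` at the exponents that are negative in every variable are zero. -/
def NegZero (f : Laurent L ι) : Prop := ∀ a : ι → ℤ, (∀ i, a i < 0) → f.coeff a = 0

lemma NegZero.zero : NegZero (0 : Laurent L ι) := fun a _ => by simp

lemma NegZero.add {f g : Laurent L ι} (hf : NegZero f) (hg : NegZero g) : NegZero (f + g) :=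
  fun a ha => by simp [hf a ha, hg a ha]

lemma NegZero.sum {α : Type*} {s : Finset α} {f : α → Laurent L ι}
    (h : ∀ i ∈ s, NegZero (f i)) : NegZero (∑ i ∈ s, f i) :=
  Finset.sum_induction _ _ (fun _ _ => NegZero.add) NegZero.zero h

lemma NegZero.zsmul {f : Laurent L ι} (hf : NegZero f) (n : ℤ) : NegZero (n • f) :=
  fun a ha => (map_zsmul ((Finsupp.applyAddHom a).comp
    (coeffAddEquiv (R := L)).toAddMonoidHom) n f).trans (by
      rw [show ((Finsupp.applyAddHom a).comp (coeffAddEquiv (R := L)).toAddMonoidHom) f = 0 from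
        hf a ha, smul_zero])

lemma negZero_of_mem_piece {s : Finset ι} {i : ι} (hi : i ∉ s) {e : ℤ} {f : Laurent L ι}
    (hf : f ∈ piece L s e) : NegZero f := fun a ha => by
  by_contra h
  exact absurd ((hf a h).1 i hi) (not_le.2 (ha i))

/-- Negative exponents cannot sum to zero; this is `H^N(ℙ^N, 𝒪) = 0`. -/
lemma negZero_of_mem_piece_zero [Nonempty ι] {s : Finset ι} {f : Laurent L ι}
    (hf : f ∈ piece L s 0) : NegZero f := fun a ha => by
  by_contra h
  have : ∑ i, a i < 0 := Finset.sum_neg (fun i _ => ha i) Finset.univ_nonempty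
  exact absurd (hf a h).2 this.ne

/-- Multiplication by a polynomial preserves the Laurent polynomials without negative part. -/
lemma NegZero.ofPoly_mul {f : Laurent L ι} (hf : NegZero f) (g : MvPolynomial ι L) :
    NegZero (ofPoly g * f) := fun a ha => by
  by_contra h
  obtain ⟨b, c, hb, hc, rfl⟩ := exists_mem_support_add h
  obtain ⟨b, rfl, -⟩ := exists_of_coeff_ofPoly_ne_zero hb
  refine hc (hf c fun i => ?_)
  have := ha i
  simp at this
  omega

lemma coeff_altSum (c : Finset ι → Laurent L ι) (t : Finset ι) (a : ι → ℤ) :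
    (altSum c t).coeff a = altSum (fun s => (c s).coeff a) t :=
  map_altSum ((Finsupp.applyAddHom a).comp (coeffAddEquiv (R := L)).toAddMonoidHom) c t

/-- The complex splits by exponent. At an exponent `a` with some `a j ≥ 0`, inverting `x_j` costs
nothing, so contraction along `j` stays inside the pieces. Entirely negative exponents occur only at
`Finset.univ`, where `hneg` excludes them. -/
theorem exists_altSum_eq [Nonempty ι] {e : ℤ} {c : Finset ι → Laurent L ι}
    (hc : ∀ s, c s ∈ piece L s e) (h : ∀ t, altSum c t = 0) (hneg : NegZero (c Finset.univ)) :
    ∃ u : Finset ι → Laurent L ι, (∀ s, u s ∈ piece L s e) ∧ altSum u = c := by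
  classical
  have hj : ∀ a : ι → ℤ, ∃ j : ι, (∃ i, 0 ≤ a i) → 0 ≤ a j := fun a => by
    by_cases H : ∃ i, 0 ≤ a i
    · exact ⟨H.choose, fun _ => H.choose_spec⟩
    · exact ⟨Classical.arbitrary ι, fun h => absurd h H⟩
  choose j hj using hj
  let σ : (ι → ℤ) → Finset ι → L := fun a => contract (j a) fun s => (c s).coeff a
  have hσ : ∀ a s, σ a s ≠ 0 → (c (insert (j a) s)).coeff a ≠ 0 := fun a s h h' => by
    refine h ?_
    simp only [σ, contract]
    split_ifs
    · rfl
    · rw [h', smul_zero]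
  let u : Finset ι → Laurent L ι := fun s => .ofCoeff <| Finsupp.onFinset
    (Finset.univ.biUnion fun i => (c (insert i s)).coeff.support) (fun a => σ a s) fun a h => by
      simp only [Finset.mem_biUnion, Finset.mem_univ, true_and]
      exact ⟨j a, Finsupp.mem_support_iff.2 (hσ a s h)⟩
  have hu : ∀ s a, (u s).coeff a = σ a s := fun s a => rfl
  refine ⟨u, fun s a ha => ?_, ?_⟩
  · have h1 := hσ a s (by rwa [← hu])
    obtain ⟨h2, h3⟩ := hc _ a h1
    refine ⟨fun i hi => ?_, h3⟩
    by_cases hij : i = j a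
    · rw [hij]
      refine hj a ?_
      by_contra! hall
      have huniv : insert (j a) s = Finset.univ := by
        ext k
        simp only [Finset.mem_univ, iff_true]
        by_contra hk
        exact absurd (h2 k hk) (not_le.2 (hall k))
      rw [huniv] at h1
      exact h1 (hneg a hall)
    · exact h2 i (by simp [hij, hi])
  · ext t a
    rw [coeff_altSum]
    simp only [hu]
    by_cases hjt : j a ∈ t
    · exact altSum_contract_of_mem _ hjt
    · refine altSum_contract_of_notMem _ hjt ?_
      rw [← coeff_altSum, h]
      rfl

/-- An element of top degree without negative part is a coboundary. -/
lemma exists_altSum_univ_eq [Nonempty ι] {e : ℤ} {w : Laurent L ι}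
    (hw : w ∈ piece L Finset.univ e) (hneg : NegZero w) :
    ∃ u : Finset ι → Laurent L ι, (∀ s, u s ∈ piece L s e) ∧ altSum u Finset.univ = w := by
  classical
  obtain ⟨u, hu, h⟩ := exists_altSum_eq (e := e)
    -- This is a cocycle because no `t.erase i` with `i ∈ t` equals `Finset.univ`.
    (c := fun s => if s = Finset.univ then w else 0)
    (fun s => by
      split_ifs with hs
      · rwa [hs]
      · exact zero_mem _)
    (fun t => altSum_eq_zero fun i _ => if_neg fun h =>
      absurd (h ▸ Finset.mem_univ i) (Finset.notMem_erase i t))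
    (by simpa using hneg)
  exact ⟨u, hu, by rw [h]; simp⟩

/-- A cocycle in the degree below the top one is a coboundary. -/
lemma exists_altSum_eq_of_altSum_univ [Nonempty ι] {e : ℤ} {c : Finset ι → Laurent L ι}
    (hc : ∀ s, c s ∈ piece L s e) (h : altSum c Finset.univ = 0) :
    ∃ u : Finset ι → Laurent L ι, (∀ s, u s ∈ piece L s e) ∧
      ∀ s, s.card + 1 = Fintype.card ι → altSum u s = c s := by
  classical
  obtain ⟨u, hu, hu'⟩ := exists_altSum_eq (e := e)
    (c := fun s => if s.card + 1 = Fintype.card ι then c s else 0)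
    (fun s => by
      split_ifs with hs
      · exact hc s
      · exact zero_mem _)
    (fun t => by
      by_cases ht : t = Finset.univ
      · subst ht
        rw [← h]
        refine altSum_congr fun i hi => if_pos ?_
        rw [Finset.card_erase_add_one hi, Finset.card_univ]
      · refine altSum_eq_zero fun i hi => if_neg fun h' => ht ?_
        rw [Finset.card_erase_add_one hi] at h'
        exact Finset.eq_univ_of_card t h')
    (by
      rw [if_neg (by simp)]
      exact NegZero.zero)
  exact ⟨u, hu, fun s hs => by rw [hu']; simp [hs]⟩

end Exactness

end Laurent

/-! ### Test ideals of powers with exponent `1 - 1 / p` -/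

section TestIdealBound

variable {R : Type*} [CommRing R] (p : ℕ) [Fact p.Prime] [CharP R p]

lemma Ideal.pow_mem_frobPow {J : Ideal R} {q : ℕ} {x : R} (hx : x ∈ J.frobPow q) (n : ℕ) :
    x ^ p ^ n ∈ J.frobPow (q * p ^ n) := by
  unfold Ideal.frobPow at hx
  induction hx using Submodule.span_induction with
  | mem x hx =>
    obtain ⟨a, ha, rfl⟩ := hx
    exact Ideal.subset_span ⟨a, ha, pow_mul a q (p ^ n)⟩
  | zero => rw [zero_pow (pow_pos (Fact.out : p.Prime).pos n).ne']; exact zero_mem _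
  | add x y _ _ hx hy => rw [add_pow_char_pow]; exact add_mem hx hy
  | smul a x _ hx => rw [smul_eq_mul, mul_pow]; exact Ideal.mul_mem_left _ _ hx

/-- The exponent at level `n + 1` is exactly `(p - 1) p^n`, and `h^((p-1) p^n)` is the `p^n`-th
power of an element of `J^[p]`, so it lies in `J^[p^(n+1)]`. -/
lemma Ideal.testIdeal_one_sub_inv_le {J : Ideal R} {h : R} (hJ : h ^ (p - 1) ∈ J.frobPow p) :
    Ideal.testIdeal p (Ideal.span {h}) (1 - 1 / (p : ℝ)) ≤ J := by
  have hp : p.Prime := Fact.out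
  refine iSup₂_le fun e he => sInf_le ?_
  obtain ⟨n, rfl⟩ : ∃ n, e = n + 1 := ⟨e - 1, by omega⟩
  have hceil : ⌈(1 - 1 / (p : ℝ)) * (p : ℝ) ^ (n + 1)⌉₊ = (p - 1) * p ^ n := by
    have h0 : (p : ℝ) ≠ 0 := by exact_mod_cast hp.ne_zero
    have : (1 - 1 / (p : ℝ)) * (p : ℝ) ^ (n + 1) = (((p - 1) * p ^ n : ℕ) : ℝ) := by
      rw [Nat.cast_mul, Nat.cast_sub hp.one_le]
      field_simp
      push_cast; ring
    rw [this, Nat.ceil_natCast]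
  change Ideal.span {h} ^ _ ≤ _
  rw [hceil, Ideal.span_singleton_pow, Ideal.span_singleton_le_iff_mem, pow_mul, pow_succ']
  exact Ideal.pow_mem_frobPow p hJ n

end TestIdealBound

/-! ### The twisted Frobenius `t ↦ h^(p-1) t^p` on negative parts -/

namespace Laurent

open AddMonoidAlgebra

variable {L ι : Type*} [Field L] [Fintype ι] [LinearOrder ι]

/-- The ideal of the polynomials `g` such that `g * t` has no negative part. -/
noncomputable def annNeg (t : Laurent L ι) : Ideal (MvPolynomial ι L) where
  carrier := {g | NegZero (ofPoly g * t)}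
  zero_mem' := by
    change NegZero _
    rw [map_zero, zero_mul]; exact NegZero.zero
  add_mem' {f g} hf hg := by
    change NegZero _
    rw [map_add, add_mul]; exact NegZero.add hf hg
  smul_mem' f g hg := by
    change NegZero _
    rw [smul_eq_mul, map_mul, mul_assoc]; exact NegZero.ofPoly_mul hg f

variable (p : ℕ) [Fact p.Prime] [CharP L p]

lemma coeff_ofPoly_pow_mul_monomial_mul (G : MvPolynomial ι L) (t : Laurent L ι) (b : ι →₀ ℕ)
    (a : ι → ℤ) : (ofPoly (G ^ p * MvPolynomial.monomial b 1) * t ^ p).coeff a =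
      ((ofPoly G * t) ^ p).coeff (-expHom ι b + a) := by
  rw [map_mul, map_pow, mul_right_comm, ← mul_pow, mul_comm, ofPoly_monomial,
    coeff_single_mul_apply, one_mul]

variable [PerfectField L]

/-- Over a perfect field, polynomials are combinations of the monomials with exponents less than
`p`, with coefficients that are `p`-th powers. -/
lemma exists_eq_sum_pow_mul_monomial (g : MvPolynomial ι L) :
    ∃ G : (ι → Fin p) → MvPolynomial ι L, g = ∑ b, G b ^ p *
      MvPolynomial.monomial (Finsupp.equivFunOnFinite.symm fun i => (b i : ℕ)) 1 := by
  classical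
  have hp : p.Prime := Fact.out
  induction g using MvPolynomial.induction_on' with
  | monomial a c =>
    obtain ⟨c', rfl⟩ : ∃ c' : L, c' ^ p = c := surjective_frobenius L p c
    -- Division with remainder of the exponents by `p`; the coefficient has a `p`-th root as `L` is
    -- perfect.
    let b₀ : ι → Fin p := fun i => ⟨a i % p, Nat.mod_lt _ hp.pos⟩
    refine ⟨fun b => if b = b₀ then
      MvPolynomial.monomial (Finsupp.equivFunOnFinite.symm fun i => a i / p) c' else 0, ?_⟩
    rw [Finset.sum_eq_single b₀]
    · simp only [if_true]
      rw [MvPolynomial.monomial_pow, MvPolynomial.monomial_mul, mul_one]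
      refine congrArg (fun x => MvPolynomial.monomial x (c' ^ p)) (Finsupp.ext fun i => ?_)
      simp [b₀, Nat.div_add_mod]
    · intro b _ hb
      simp [hb, zero_pow hp.ne_zero]
    · simp
  | add f g hf hg =>
    obtain ⟨F, hF⟩ := hf
    obtain ⟨G, hG⟩ := hg
    refine ⟨F + G, ?_⟩
    simp only [Pi.add_apply, add_pow_char, add_mul, Finset.sum_add_distrib]
    rw [← hF, ← hG]

/-- In `g = ∑ G_b^p x^b` the exponents of `G_b^p x^b t^p` are congruent to `b` modulo `p`. So the
coefficient of `g t^p` at `p v + b` is the `p`-th power of that of `G_b t` at `v`. -/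
lemma mem_frobPow_annNeg {t : Laurent L ι} {g : MvPolynomial ι L}
    (h : NegZero (ofPoly g * t ^ p)) : g ∈ (annNeg t).frobPow p := by
  have hp : p.Prime := Fact.out
  obtain ⟨G, rfl⟩ := exists_eq_sum_pow_mul_monomial p g
  refine sum_mem fun b _ => Ideal.mul_mem_right _ _ (Ideal.subset_span ⟨G b, ?_, rfl⟩)
  intro v hv
  let e : (ι → Fin p) → (ι →₀ ℕ) := fun b => Finsupp.equivFunOnFinite.symm fun i => (b i : ℕ)
  -- This exponent is negative in every variable, as `v i ≤ -1` and `b i ≤ p - 1`.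
  have key := h (p • v + expHom ι (e b)) fun i => by
    have h1 := hv i
    have h2 := (b i).2
    simp [e]
    nlinarith
  rw [map_sum, Finset.sum_mul, coeff_sum, Finsupp.finsetSum_apply,
    Finset.sum_eq_single_of_mem b (Finset.mem_univ _)] at key
  · rw [coeff_ofPoly_pow_mul_monomial_mul] at key
    rw [show -expHom ι (e b) + (p • v + expHom ι (e b)) = p • v by abel, coeff_pow_smul] at key
    exact pow_eq_zero_iff hp.ne_zero |>.1 key
  · intro b' _ hb'
    rw [coeff_ofPoly_pow_mul_monomial_mul]
    by_contra hne
    obtain ⟨v', hv'⟩ := exists_of_coeff_pow_ne_zero p hne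
    refine hb' (funext fun i => Fin.ext ?_)
    have h1 := congrFun hv' i
    simp [e] at h1
    have h2 := (b i).2
    have h3 := (b' i).2
    have h4 : ((b' i : ℕ) : ℤ) - (b i : ℕ) = p * (v i - v' i) := by linarith
    have h5 : (p : ℤ) ∣ ((b' i : ℕ) : ℤ) - (b i : ℕ) := ⟨_, h4⟩
    have := Int.eq_zero_of_abs_lt_dvd h5 (by rw [abs_lt]; omega)
    omega

/-- If the test ideal is large, the Frobenius action on the negative part of the Laurent
polynomials, twisted by `h ^ (p - 1)`, is injective in degree `-d`. -/
theorem negZero_of_negZero_pow {d : ℕ} (hd : Fintype.card ι ≤ d) {h : MvPolynomial ι L}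
    (hτ : Ideal.span (Set.range (MvPolynomial.X : ι → MvPolynomial ι L)) ^
      (d - Fintype.card ι) ≤ Ideal.testIdeal p (Ideal.span {h}) (1 - 1 / (p : ℝ)))
    {t : Laurent L ι} (ht : t ∈ piece L Finset.univ (-d))
    (hneg : NegZero (ofPoly (h ^ (p - 1)) * t ^ p)) : NegZero t := by
  intro a ha
  by_contra hne
  have hle := hτ.trans (Ideal.testIdeal_one_sub_inv_le p (mem_frobPow_annNeg p hneg))
  -- The monomial moving `a` to `(-1, …, -1)`; its degree is `d - Fintype.card ι` because `a` has
  -- sum `-d`.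
  let b : ι →₀ ℕ := Finsupp.equivFunOnFinite.symm fun i => (-a i - 1).toNat
  have hb : ∀ i, (b i : ℤ) = -a i - 1 := fun i => by
    have := ha i
    simp [b]; omega
  have hdeg : ∑ i, (b i : ℤ) = d - Fintype.card ι := by
    simp only [hb, Finset.sum_sub_distrib, Finset.sum_neg_distrib, (ht a hne).2]
    simp
  have hmem : MvPolynomial.monomial b (1 : L) ∈ annNeg t := by
    refine hle ?_
    have : b.degree = d - Fintype.card ι := by
      rw [Finsupp.degree_eq_sum]
      zify [hd]
      exact hdeg
    rw [← this]
    change _ ∈ MvPolynomial.idealOfVars ι L ^ _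
    rw [MvPolynomial.mem_pow_idealOfVars_iff']
    intro x hx
    rw [MvPolynomial.coeff_monomial, if_neg]
    rintro rfl
    exact lt_irrefl _ hx
  have := hmem (fun _ => -1) (by simp)
  rw [ofPoly_monomial, coeff_single_mul_apply, one_mul] at this
  refine hne ?_
  rwa [show -expHom ι b + (fun _ => -1) = a by ext i; simp [hb]] at this

/-- If the test ideal is large, the Frobenius action on the negative part of the Laurent
polynomials, twisted by `h ^ (p - 1)`, is surjective in degree `-d`. -/
theorem exists_negZero_sub {d : ℕ} (hd : Fintype.card ι ≤ d) {h : MvPolynomial ι L}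
    (hh : h.IsHomogeneous d)
    (hτ : Ideal.span (Set.range (MvPolynomial.X : ι → MvPolynomial ι L)) ^
      (d - Fintype.card ι) ≤ Ideal.testIdeal p (Ideal.span {h}) (1 - 1 / (p : ℝ)))
    {t : Laurent L ι} (ht : t ∈ piece L Finset.univ (-d)) :
    ∃ t' ∈ piece L Finset.univ (-d), NegZero (t - ofPoly (h ^ (p - 1)) * t' ^ p) := by
  classical
  have hp : p.Prime := Fact.out
  -- The monomial basis of `H^N(ℙ^N, 𝒪(-d))`. The lower bound `-d` is automatic and only makes the
  -- set visibly finite.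
  let T : Finset (ι → ℤ) := (Fintype.piFinset fun _ => Finset.Icc (-d : ℤ) (-1)).filter
    fun a => ∑ i, a i = -d
  have hT : ∀ a : ι → ℤ, a ∈ T ↔ (∀ i, a i < 0) ∧ ∑ i, a i = -d := fun a => by
    simp only [T, Finset.mem_filter, Fintype.mem_piFinset, Finset.mem_Icc]
    refine ⟨fun h => ⟨fun i => by have := (h.1 i).2; omega, h.2⟩, fun h => ⟨fun i => ?_, h.2⟩⟩
    refine ⟨?_, by have := h.1 i; omega⟩
    rw [← h.2, ← Finset.add_sum_erase _ _ (Finset.mem_univ i)]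
    have : ∑ j ∈ Finset.univ.erase i, a j ≤ 0 := Finset.sum_nonpos fun j _ => (h.1 j).le
    omega
  let elt : (T → L) → Laurent L ι := fun c => ∑ a : T, single a.1 (c a)
  have helt : ∀ c, elt c ∈ piece L Finset.univ (-d) := fun c => sum_mem fun a _ => by
    have := single_mem_piece (s := Finset.univ) (a := a.1) (by simp) (c a)
    rwa [((hT _).1 a.2).2] at this
  have coeff_elt : ∀ c (a : T), (elt c).coeff a.1 = c a := fun c a => by
    rw [coeff_sum, Finsupp.finsetSum_apply, Finset.sum_eq_single_of_mem a (Finset.mem_univ _)]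
    · simp
    · intro b _ hb
      rw [coeff_single, Finsupp.single_apply, if_neg fun h => hb (Subtype.ext h)]
  set H : Laurent L ι := ofPoly (h ^ (p - 1)) with hH
  -- The linear part of the twisted Frobenius, which is `M` composed with the coordinatewise `p`-th
  -- power. The latter is onto as `L` is perfect, so injectivity and surjectivity can be handled on
  -- `M`.
  let M : (T → L) →ₗ[L] (T → L) :=
    { toFun := fun c b => ∑ a : T, H.coeff (b.1 - p • a.1) * c a
      map_add' := fun c c' => by ext b; simp [mul_add, Finset.sum_add_distrib]
      map_smul' := fun r c => by ext b; simp [Finset.mul_sum, mul_left_comm] }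
  have hM : ∀ e (b : T), (H * elt e ^ p).coeff b.1 = M (fun a => e a ^ p) b := fun e b => by
    simp only [elt, sum_pow_char, single_pow, Finset.mul_sum, coeff_sum, Finsupp.finsetSum_apply]
    refine Finset.sum_congr rfl fun a _ => ?_
    rw [mul_comm, coeff_single_mul_apply, neg_add_eq_sub, mul_comm]
  have hdegH : ∀ e, H * elt e ^ p ∈ piece L Finset.univ (-d) := fun e => by
    have h1 : H ∈ piece L Finset.univ _ := ofPoly_mem_piece (hh.pow (p - 1)) _
    have h2 := mul_mem_piece h1 (pow_mem_piece (helt e) p)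
    rwa [show ((d * (p - 1) : ℕ) : ℤ) + p * -(d : ℤ) = -d by
      rw [Nat.cast_mul, Nat.cast_sub hp.one_le]; push_cast; ring] at h2
  have hneg : ∀ f ∈ piece L Finset.univ (-d : ℤ), (∀ b : T, f.coeff b.1 = 0) → NegZero f :=
    fun f hf h0 a ha => by
      by_contra hne
      exact hne (h0 ⟨a, (hT a).2 ⟨ha, (hf a hne).2⟩⟩)
  have hroot : ∀ c : T → L, ∃ e : T → L, (fun a => e a ^ p) = c := fun c => by
    choose e he using fun a => surjective_frobenius L p (c a)
    exact ⟨e, funext he⟩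
  have hinj : Function.Injective M := by
    rw [← LinearMap.ker_eq_bot, LinearMap.ker_eq_bot']
    intro c hc
    obtain ⟨e, rfl⟩ := hroot c
    have h1 : NegZero (H * elt e ^ p) := hneg _ (hdegH e) fun b => by rw [hM, hc]; rfl
    have h2 := negZero_of_negZero_pow p hd hτ (helt e) h1
    ext a
    have := h2 a.1 ((hT _).1 a.2).1
    rw [coeff_elt] at this
    simp [this, zero_pow hp.ne_zero]
  obtain ⟨c, hc⟩ := LinearMap.surjective_of_injective hinj fun b => t.coeff b.1
  obtain ⟨e, rfl⟩ := hroot c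
  refine ⟨elt e, helt e, hneg _ (sub_mem ht (hdegH e)) fun b => ?_⟩
  rw [coeff_sub, Finsupp.sub_apply, hM, hc, sub_self]

end Laurent

/-! ### Representing elements of localizations by Laurent polynomials -/

namespace Laurent

variable {L ι : Type*} [Field L] [Fintype ι] {K : Type*} [CommRing K]

lemma prodPow_natCast_mul_ofPoly (s : Finset ι) (k : ℕ) (g : MvPolynomial ι L) :
    prodPow L s k * ofPoly g = ofPoly ((∏ i ∈ s, MvPolynomial.X i) ^ k * g) := by
  rw [prodPow_natCast, map_mul]

/-- The pairs consisting of a Laurent polynomial `f` which is a polynomial up to powers of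
`∏ i ∈ s, x_i`, and of an element that deserves to be called the image of `f` under the
ring homomorphism `ψ`. -/
noncomputable def rep (ψ : MvPolynomial ι L →+* K) (s : Finset ι) : Subring (Laurent L ι × K) where
  carrier := {x | ∃ (m : ℕ) (g : MvPolynomial ι L), prodPow L s m * x.1 = ofPoly g ∧
    ψ g = ψ (∏ i ∈ s, MvPolynomial.X i) ^ m * x.2}
  one_mem' := ⟨0, 1, by simp [prodPow_zero], by simp⟩
  zero_mem' := ⟨0, 0, by simp, by simp⟩
  neg_mem' := by
    rintro ⟨f, y⟩ ⟨m, g, h1, h2⟩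
    exact ⟨m, -g, by simpa using h1, by simpa using h2⟩
  mul_mem' := by
    rintro ⟨f, y⟩ ⟨f', y'⟩ ⟨m, g, h1, h2⟩ ⟨m', g', h1', h2'⟩
    refine ⟨m + m', g * g', ?_, ?_⟩
    · rw [map_mul, ← h1, ← h1', Nat.cast_add, prodPow_add]
      simp only [Prod.mk_mul_mk]; ring
    · rw [map_mul, h2, h2', pow_add]
      simp only [Prod.mk_mul_mk]; ring
  add_mem' := by
    rintro ⟨f, y⟩ ⟨f', y'⟩ ⟨m, g, h1, h2⟩ ⟨m', g', h1', h2'⟩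
    refine ⟨m + m', (∏ i ∈ s, MvPolynomial.X i) ^ m' * g + (∏ i ∈ s, MvPolynomial.X i) ^ m * g',
      ?_, ?_⟩
    · rw [map_add, ← prodPow_natCast_mul_ofPoly, ← prodPow_natCast_mul_ofPoly, ← h1, ← h1',
        Nat.cast_add, prodPow_add]
      simp only [Prod.mk_add_mk]; ring
    · rw [map_add, map_mul, map_mul, map_pow, map_pow, h2, h2', pow_add]
      simp only [Prod.mk_add_mk]; ring

lemma mem_rep {ψ : MvPolynomial ι L →+* K} {s : Finset ι} {f : Laurent L ι} {y : K} :
    (f, y) ∈ rep ψ s ↔ ∃ (m : ℕ) (g : MvPolynomial ι L), prodPow L s m * f = ofPoly g ∧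
      ψ g = ψ (∏ i ∈ s, MvPolynomial.X i) ^ m * y := Iff.rfl

/-- With additivity, this makes `rep` single-valued in its second component. -/
lemma eq_zero_of_mem_rep {ψ : MvPolynomial ι L →+* K} {s : Finset ι} {y : K}
    (hu : IsUnit (ψ (∏ i ∈ s, MvPolynomial.X i))) (h : (0, y) ∈ rep ψ s) : y = 0 := by
  obtain ⟨m, g, h1, h2⟩ := mem_rep.1 h
  rw [mul_zero] at h1
  obtain rfl : g = 0 := ofPoly_injective (by rw [← h1, map_zero])
  rw [map_zero] at h2
  exact ((hu.pow m).mul_right_eq_zero).1 h2.symm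

lemma mem_rep_of_subset {ψ : MvPolynomial ι L →+* K} {K' : Type*} [CommRing K']
    {ψ' : MvPolynomial ι L →+* K'} (θ : K →+* K') (hθ : ∀ g, θ (ψ g) = ψ' g) {s t : Finset ι}
    (hst : s ⊆ t) {f : Laurent L ι} {y : K} (h : (f, y) ∈ rep ψ s) : (f, θ y) ∈ rep ψ' t := by
  classical
  obtain ⟨m, g, h1, h2⟩ := mem_rep.1 h
  have h3 := Finset.prod_sdiff (f := (MvPolynomial.X : ι → MvPolynomial ι L)) hst
  refine mem_rep.2 ⟨m, (∏ i ∈ t \ s, MvPolynomial.X i) ^ m * g, ?_, ?_⟩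
  · rw [prodPow_natCast, ← h3, map_mul, ← h1, prodPow_natCast, mul_pow, map_mul]
    ring
  · rw [← h3, map_mul, ← hθ g, h2, map_mul, map_pow, map_pow, map_mul, hθ]
    ring

end Laurent

/-! ### Sections of the structure sheaf of a hypersurface -/

/-- A presentation of a graded ring as the quotient of a polynomial ring by the form `h`. -/
structure FormPresentation {L ι A : Type*} [Field L] [CommRing A] [Algebra L A]
    (𝒜 : ℕ → Submodule L A) (h : MvPolynomial ι L) where
  /-- The quotient map. -/
  π : MvPolynomial ι L →+* A
  map_mem {n : ℕ} {g : MvPolynomial ι L} (hg : g.IsHomogeneous n) : π g ∈ 𝒜 n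
  exists_map_eq {n : ℕ} {a : A} (ha : a ∈ 𝒜 n) : ∃ g : MvPolynomial ι L, g.IsHomogeneous n ∧ π g = a
  map_eq_zero_iff (g : MvPolynomial ι L) : π g = 0 ↔ h ∣ g

namespace FormPresentation

open Laurent HomogeneousLocalization

variable {L ι : Type*} {A : Type u} [Field L] [Fintype ι] [CommRing A] [Algebra L A]
  {𝒜 : ℕ → Submodule L A} {h : MvPolynomial ι L} (P : FormPresentation 𝒜 h)

/-- The image of the product of the variables `x_i`, `i ∈ s`. -/
noncomputable def prodX (s : Finset ι) : A := P.π (∏ i ∈ s, MvPolynomial.X i)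

lemma prodX_mem (s : Finset ι) : P.prodX s ∈ 𝒜 s.card := by
  refine P.map_mem ?_
  have := MvPolynomial.IsHomogeneous.prod s (MvPolynomial.X : ι → MvPolynomial ι L) (fun _ => 1)
    fun i _ => MvPolynomial.isHomogeneous_X L i
  simpa using this

/-- The map from polynomials to the localization of `A` at the product of the variables `x_i`,
`i ∈ s`. -/
noncomputable def toLoc (s : Finset ι) : MvPolynomial ι L →+* Localization.Away (P.prodX s) :=
  (algebraMap A _).comp P.π

lemma isUnit_toLoc (s : Finset ι) : IsUnit (P.toLoc s (∏ i ∈ s, MvPolynomial.X i)) :=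
  IsLocalization.Away.algebraMap_isUnit (P.prodX s)

variable [GradedAlgebra 𝒜]

lemma toLoc_eq {s : Finset ι} {m : ℕ} {g : MvPolynomial ι L} {hg : P.π g ∈ 𝒜 (m • s.card)} :
    P.toLoc s g = P.toLoc s (∏ i ∈ s, MvPolynomial.X i) ^ m *
      (Away.mk 𝒜 (P.prodX_mem s) m (P.π g) hg).val := by
  rw [Away.val_mk, Localization.mk_eq_mk', ← map_pow]
  simp only [toLoc, RingHom.comp_apply, map_pow]
  rw [← map_pow]
  exact (IsLocalization.mk'_spec' (Localization.Away (P.prodX s)) (P.π g)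
    (⟨P.prodX s ^ m, ⟨m, rfl⟩⟩ : Submonoid.powers (P.prodX s))).symm

lemma exists_rep {s : Finset ι} {f : Laurent L ι} (hf : f ∈ piece L s 0) :
    ∃ z : Away 𝒜 (P.prodX s), (f, z.val) ∈ rep (P.toLoc s) s := by
  obtain ⟨m, hm⟩ := exists_prodPow_mul_eq hf
  obtain ⟨g, hg⟩ := hm m le_rfl
  have h1 : ofPoly g ∈ piece L s (m * s.card + 0) :=
    hg ▸ mul_mem_piece (prodPow_mem_piece s m) hf
  have h2 : g.IsHomogeneous (m * s.card) :=
    isHomogeneous_of_ofPoly_mem (s := s) (by push_cast; rwa [add_zero] at h1)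
  exact ⟨_, mem_rep.2 ⟨m, g, hg, P.toLoc_eq (hg := P.map_mem h2)⟩⟩

lemma exists_mem_piece_rep {s : Finset ι} (z : Away 𝒜 (P.prodX s)) :
    ∃ f ∈ piece L s 0, (f, z.val) ∈ rep (P.toLoc s) s := by
  obtain ⟨m, a, ha, rfl⟩ := Away.mk_surjective 𝒜 (P.prodX_mem s) z
  obtain ⟨g, hg, rfl⟩ := P.exists_map_eq ha
  refine ⟨prodPow L s (-m) * ofPoly g, ?_, mem_rep.2 ⟨m, g, ?_, P.toLoc_eq⟩⟩
  · have := mul_mem_piece (prodPow_mem_piece (L := L) s (-m)) (ofPoly_mem_piece hg s)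
    rwa [show (-m * s.card + ((m • s.card : ℕ) : ℤ) : ℤ) = 0 by
      rw [smul_eq_mul]; push_cast; ring] at this
  · rw [← mul_assoc, prodPow_mul_neg, one_mul]

lemma rep_mul_zero {s : Finset ι} {e : ℤ} {w : Laurent L ι} (hw : w ∈ piece L s e) :
    (ofPoly h * w, 0) ∈ rep (P.toLoc s) s := by
  obtain ⟨m, hm⟩ := exists_prodPow_mul_eq hw
  obtain ⟨g, hg⟩ := hm m le_rfl
  refine mem_rep.2 ⟨m, h * g, by rw [map_mul, ← hg]; ring, ?_⟩
  rw [mul_zero, toLoc, RingHom.comp_apply, (P.map_eq_zero_iff _).2 (dvd_mul_right h g), map_zero]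

omit [Fintype ι] in
-- The component of `q` in degree `D - d` works. This covers `h = 0`, where `q` itself is arbitrary,
-- and `d > D`, where `f` vanishes.
lemma _root_.MvPolynomial.exists_isHomogeneous_mul_eq {d : ℕ} (hh : h.IsHomogeneous d) {D : ℕ}
    {f q : MvPolynomial ι L} (hf : f.IsHomogeneous D) (hq : f = h * q) :
    ∃ q', f = h * q' ∧ (q' = 0 ∨ ∃ n, q'.IsHomogeneous n ∧ d + n = D) := by
  let := MvPolynomial.gradedAlgebra (σ := ι) (R := L)
  have h1 := MvPolynomial.homogeneousComponent_of_mem hf (m := D)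
  have key := DirectSum.coe_decompose_mul_of_left_mem
    (MvPolynomial.homogeneousSubmodule ι L) D (b := q) hh
  rw [← hq] at key
  erw [MvPolynomial.decomposition.decompose'_apply, MvPolynomial.decomposition.decompose'_apply,
    h1] at key
  rw [if_pos rfl] at key
  by_cases hdD : d ≤ D
  · rw [if_pos hdD] at key
    exact ⟨MvPolynomial.homogeneousComponent (D - d) q, key, .inr ⟨D - d,
      MvPolynomial.homogeneousComponent_isHomogeneous _ _, by omega⟩⟩
  · rw [if_neg hdD] at key
    exact ⟨0, by rw [key, mul_zero], .inl rfl⟩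

/-- After clearing denominators `f` becomes a form divisible by `h`; a homogeneous quotient, divided
by the same monomial, is `w`. -/
lemma exists_eq_mul_of_rep_zero {d : ℕ} (hh : h.IsHomogeneous d) {s : Finset ι} {f : Laurent L ι}
    (hf : f ∈ piece L s 0) (h0 : (f, 0) ∈ rep (P.toLoc s) s) :
    ∃ w ∈ piece L s (-d), f = ofPoly h * w := by
  obtain ⟨m, g, h1, h2⟩ := mem_rep.1 h0
  rw [mul_zero, toLoc, RingHom.comp_apply,
    IsLocalization.map_eq_zero_iff (Submonoid.powers (P.prodX s))] at h2
  obtain ⟨⟨_, k, rfl⟩, hk⟩ := h2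
  have hk' : P.π ((∏ i ∈ s, MvPolynomial.X i) ^ k * g) = 0 := by
    rw [map_mul, map_pow]; exact hk
  obtain ⟨q, hq⟩ := (P.map_eq_zero_iff _).1 hk'
  have h3 : prodPow L s ((k + m : ℕ) : ℤ) * f = ofPoly ((∏ i ∈ s, MvPolynomial.X i) ^ k * g) := by
    rw [← prodPow_natCast_mul_ofPoly, ← h1, Nat.cast_add, prodPow_add, mul_assoc]
  have h4 : ((∏ i ∈ s, MvPolynomial.X i) ^ k * g).IsHomogeneous ((k + m) * s.card) := by
    refine isHomogeneous_of_ofPoly_mem (s := s) ?_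
    rw [← h3]
    have := mul_mem_piece (prodPow_mem_piece (L := L) s ((k + m : ℕ) : ℤ)) hf
    rw [add_zero] at this
    exact_mod_cast this
  obtain ⟨q', hq', hn⟩ := MvPolynomial.exists_isHomogeneous_mul_eq hh h4 hq
  refine ⟨prodPow L s (-((k + m : ℕ) : ℤ)) * ofPoly q', ?_, ?_⟩
  · rcases hn with rfl | ⟨n, hn, hn'⟩
    · rw [map_zero, mul_zero]; exact zero_mem _
    · have := mul_mem_piece (prodPow_mem_piece (L := L) s (-((k + m : ℕ) : ℤ)))
        (ofPoly_mem_piece hn s)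
      rwa [show -((k + m : ℕ) : ℤ) * s.card + n = -d by
        rw [neg_mul]
        zify at hn'
        rw [Nat.cast_add, ← hn']; ring] at this
  · rw [mul_left_comm, ← map_mul, ← hq', ← h3, ← mul_assoc, prodPow_neg_mul, one_mul]

end FormPresentation

/-! ### Laurent representatives of sections on the charts of `Proj` -/

namespace FormPresentation

open Laurent HomogeneousLocalization AltCech TopologicalSpace Opposite

variable {L ι : Type*} {A : Type u} [Field L] [Fintype ι] [LinearOrder ι] [CommRing A] [Algebra L A]
  {𝒜 : ℕ → Submodule L A} {h : MvPolynomial ι L} (P : FormPresentation 𝒜 h) [GradedAlgebra 𝒜]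

/-- The standard affine open subsets. -/
noncomputable def chart (i : ι) : (Proj 𝒜).Opens := Proj.basicOpen 𝒜 (P.π (MvPolynomial.X i))

lemma inter_chart (s : Finset ι) :
    inter (⊤ : (Proj 𝒜).Opens) P.chart s = Proj.basicOpen 𝒜 (P.prodX s) := by
  induction s using Finset.induction_on with
  | empty =>
    rw [inter_empty, prodX, Finset.prod_empty, map_one, Proj.basicOpen_one]
  | insert a s ha ih =>
    rw [prodX, Finset.prod_insert ha, map_mul, Proj.basicOpen_mul]
    rw [prodX] at ih
    rw [← ih]
    simp only [inter, top_inf_eq, Finset.inf_insert]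
    rfl

lemma isAffineOpen_inter_chart {s : Finset ι} (hs : s.Nonempty) :
    IsAffineOpen (inter (⊤ : (Proj 𝒜).Opens) P.chart s) := by
  rw [inter_chart]
  exact Proj.isAffineOpen_basicOpen 𝒜 _ (P.prodX_mem s) hs.card_pos

lemma map_mem_span {n : ℕ} {g : MvPolynomial ι L} (hg : g.IsHomogeneous n) (hn : n ≠ 0) :
    P.π g ∈ Ideal.span (Set.range fun i => P.π (MvPolynomial.X i)) := by
  have h1 : g ∈ MvPolynomial.idealOfVars ι L := by
    rw [← pow_one (MvPolynomial.idealOfVars ι L), MvPolynomial.mem_pow_idealOfVars_iff']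
    intro x hx
    by_contra hne
    have := hg hne
    obtain rfl : x = 0 := by
      rw [← Finsupp.degree_eq_zero_iff]; omega
    simp at this
    exact hn this.symm
  have h2 := Ideal.mem_map_of_mem P.π h1
  rwa [Ideal.map_span, ← Set.range_comp] at h2

/-- The variables generate the irrelevant ideal. -/
lemma iSup_chart : ⨆ i, P.chart i = ⊤ := by
  refine Proj.iSup_basicOpen_eq_top 𝒜 _ fun a ha => ?_
  classical
  rw [← DirectSum.sum_support_decompose 𝒜 a]
  refine sum_mem fun n _ => ?_
  by_cases hn : n = 0
  · subst hn
    have : (DirectSum.decompose 𝒜 a 0 : A) = 0 := (HomogeneousIdeal.mem_irrelevant_iff 𝒜 a).1 ha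
    rw [this]
    exact zero_mem _
  · obtain ⟨g, hg, hga⟩ := P.exists_map_eq (DirectSum.decompose 𝒜 a n).2
    rw [← hga]
    exact P.map_mem_span hg hn

/-- The sections defined by the elements of degree zero of a localization. -/
noncomputable def toSection (s : Finset ι) :
    Away 𝒜 (P.prodX s) →+* Γ(Proj 𝒜, inter (⊤ : (Proj 𝒜).Opens) P.chart s) :=
  (resHom (P.inter_chart s).le).comp (Proj.awayToSection 𝒜 (P.prodX s)).hom

lemma bijective_toSection {s : Finset ι} (hs : s.Nonempty) :
    Function.Bijective (P.toSection s) := by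
  have h1 : Function.Bijective (Proj.awayToSection 𝒜 (P.prodX s)).hom :=
    ConcreteCategory.bijective_of_isIso
      (Proj.basicOpenIsoAway 𝒜 (P.prodX s) (P.prodX_mem s) hs.card_pos).hom
  have h2 : ∀ {U V : (Proj 𝒜).Opens} (e : V = U), Function.Bijective (resHom e.le) := by
    rintro U _ rfl
    refine ⟨Function.LeftInverse.injective (g := id) fun x => ?_,
      Function.RightInverse.surjective (g := id) fun x => ?_⟩ <;>
    exact res_self (F := (Proj 𝒜).structureAbSheaf.obj) le_rfl x
  exact (h2 (P.inter_chart s)).comp h1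

lemma toSection_res {s t : Finset ι} (hst : s ⊆ t) : ∃ θ : Away 𝒜 (P.prodX s) →+* Away 𝒜 (P.prodX t),
    (∀ z, resHom (inter_anti (⊤ : (Proj 𝒜).Opens) P.chart hst) (P.toSection s z) =
      P.toSection t (θ z)) ∧
    ∀ (f : Laurent L ι) (z), (f, z.val) ∈ rep (P.toLoc s) s → (f, (θ z).val) ∈ rep (P.toLoc t) t := by
  have hx : P.prodX t = P.prodX s * P.prodX (t \ s) := by
    rw [prodX, prodX, prodX, ← map_mul, mul_comm, Finset.prod_sdiff hst]
  refine ⟨awayMap 𝒜 (P.prodX_mem (t \ s)) hx, fun z => ?_, fun f z hz => ?_⟩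
  · have := congrArg (fun φ => φ.hom z)
      (Proj.awayMap_awayToSection 𝒜 (P.prodX_mem (t \ s)) hx)
    change (Proj.awayToSection 𝒜 _).hom (awayMap 𝒜 (P.prodX_mem (t \ s)) hx z) =
      resHom _ ((Proj.awayToSection 𝒜 _).hom z) at this
    simp only [toSection, RingHom.comp_apply, this, resHom_resHom]
  · rw [val_awayMap]
    refine mem_rep_of_subset _ (fun g => ?_) hst hz
    exact IsLocalization.lift_eq _ _

/-- The pairs of a Laurent polynomial and of the section that it defines. -/
noncomputable def secRep (s : Finset ι) :
    Subring (Laurent L ι × Γ(Proj 𝒜, inter (⊤ : (Proj 𝒜).Opens) P.chart s)) :=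
  ((rep (P.toLoc s) s).comap ((RingHom.id (Laurent L ι)).prodMap
    (algebraMap (Away 𝒜 (P.prodX s)) (Localization.Away (P.prodX s))))).map
    ((RingHom.id (Laurent L ι)).prodMap (P.toSection s))

lemma mem_secRep {s : Finset ι} {f : Laurent L ι}
    {σ : Γ(Proj 𝒜, inter (⊤ : (Proj 𝒜).Opens) P.chart s)} :
    (f, σ) ∈ P.secRep s ↔ ∃ z : Away 𝒜 (P.prodX s),
      (f, z.val) ∈ rep (P.toLoc s) s ∧ P.toSection s z = σ := by
  constructor
  · rintro ⟨⟨f', z⟩, hz, he⟩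
    obtain ⟨rfl, rfl⟩ := Prod.mk.inj he
    exact ⟨z, hz, rfl⟩
  · rintro ⟨z, hz, rfl⟩
    exact ⟨(f, z), hz, rfl⟩

lemma secRep_res {s t : Finset ι} (hst : s ⊆ t) {f : Laurent L ι}
    {σ : Γ(Proj 𝒜, inter (⊤ : (Proj 𝒜).Opens) P.chart s)} (hf : (f, σ) ∈ P.secRep s) :
    (f, resHom (inter_anti (⊤ : (Proj 𝒜).Opens) P.chart hst) σ) ∈ P.secRep t := by
  obtain ⟨z, hz, rfl⟩ := P.mem_secRep.1 hf
  obtain ⟨θ, h1, h2⟩ := P.toSection_res hst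
  exact P.mem_secRep.2 ⟨θ z, h2 f z hz, (h1 z).symm⟩

lemma eq_of_mem_secRep {s : Finset ι} {f : Laurent L ι}
    {σ τ : Γ(Proj 𝒜, inter (⊤ : (Proj 𝒜).Opens) P.chart s)} (hσ : (f, σ) ∈ P.secRep s)
    (hτ : (f, τ) ∈ P.secRep s) : σ = τ := by
  rw [← sub_eq_zero]
  have := sub_mem hσ hτ
  rw [Prod.mk_sub_mk, sub_self] at this
  obtain ⟨z, hz, h1⟩ := P.mem_secRep.1 this
  rw [← h1, HomogeneousLocalization.val_injective _
    ((eq_zero_of_mem_rep (P.isUnit_toLoc s) hz).trans (val_zero).symm), map_zero]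

lemma exists_secRep {s : Finset ι} {f : Laurent L ι} (hf : f ∈ piece L s 0) :
    ∃ σ, (f, σ) ∈ P.secRep s := by
  obtain ⟨z, hz⟩ := P.exists_rep hf
  exact ⟨_, P.mem_secRep.2 ⟨z, hz, rfl⟩⟩

lemma exists_mem_piece_secRep {s : Finset ι} (hs : s.Nonempty)
    (σ : Γ(Proj 𝒜, inter (⊤ : (Proj 𝒜).Opens) P.chart s)) :
    ∃ f ∈ piece L s 0, (f, σ) ∈ P.secRep s := by
  obtain ⟨z, rfl⟩ := (P.bijective_toSection hs).2 σ
  obtain ⟨f, hf, hz⟩ := P.exists_mem_piece_rep z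
  exact ⟨f, hf, P.mem_secRep.2 ⟨z, hz, rfl⟩⟩

lemma secRep_mul_zero {s : Finset ι} {e : ℤ} {w : Laurent L ι} (hw : w ∈ piece L s e) :
    (ofPoly h * w, 0) ∈ P.secRep s :=
  P.mem_secRep.2 ⟨0, by rw [val_zero]; exact P.rep_mul_zero hw, map_zero _⟩

lemma exists_eq_mul_of_secRep_zero {d : ℕ} (hh : h.IsHomogeneous d) {s : Finset ι}
    (hs : s.Nonempty) {f : Laurent L ι} (hf : f ∈ piece L s 0) (h0 : (f, 0) ∈ P.secRep s) :
    ∃ w ∈ piece L s (-d), f = ofPoly h * w := by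
  obtain ⟨z, hz, h1⟩ := P.mem_secRep.1 h0
  obtain rfl : z = 0 := (P.bijective_toSection hs).1 (h1.trans (map_zero _).symm)
  rw [val_zero] at hz
  exact P.exists_eq_mul_of_rep_zero hh hf hz

/-- The Čech cochains of the structure sheaf. -/
abbrev Coch : Type _ := Cochain (Proj 𝒜).structureAbSheaf.obj (⊤ : (Proj 𝒜).Opens) P.chart

/-- The Laurent polynomial `f` defines the section `σ`. -/
def IsRep (s : Finset ι) (f : Laurent L ι)
    (σ : (Proj 𝒜).structureAbSheaf.obj.obj (op (inter (⊤ : (Proj 𝒜).Opens) P.chart s))) : Prop :=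
  (f, (show Γ(Proj 𝒜, inter (⊤ : (Proj 𝒜).Opens) P.chart s) from σ)) ∈ P.secRep s

variable {P}

lemma IsRep.add {s : Finset ι} {f f' : Laurent L ι} {σ σ'} (hf : P.IsRep s f σ)
    (hf' : P.IsRep s f' σ') : P.IsRep s (f + f') (σ + σ') := (P.secRep s).add_mem hf hf'

lemma IsRep.sub {s : Finset ι} {f f' : Laurent L ι} {σ σ'} (hf : P.IsRep s f σ)
    (hf' : P.IsRep s f' σ') : P.IsRep s (f - f') (σ - σ') := (P.secRep s).sub_mem hf hf'

lemma IsRep.zero (s : Finset ι) : P.IsRep s 0 0 := (P.secRep s).zero_mem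

lemma IsRep.zsmul {s : Finset ι} {f : Laurent L ι} {σ} (hf : P.IsRep s f σ) (n : ℤ) :
    P.IsRep s (n • f) (n • σ) := (P.secRep s).toAddSubgroup.zsmul_mem hf n

lemma IsRep.altSum {t : Finset ι} {f : Finset ι → Laurent L ι} {c}
    (hf : ∀ i ∈ t, P.IsRep t (f (t.erase i)) (c (t.erase i))) :
    P.IsRep t (altSum f t) (altSum c t) := by
  unfold _root_.altSum
  have : ∀ T ⊆ t, P.IsRep t (∑ i ∈ T, posSign i t • f (t.erase i))
      (∑ i ∈ T, posSign i t • c (t.erase i)) := by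
    intro T
    induction T using Finset.induction_on with
    | empty => intro _; exact IsRep.zero t
    | insert i T hi ih =>
      intro hT
      rw [Finset.sum_insert hi, Finset.sum_insert hi]
      exact ((hf i (hT (Finset.mem_insert_self i T))).zsmul _).add
        (ih ((Finset.subset_insert i T).trans hT))
  exact this t subset_rfl

lemma IsRep.d {t : Finset ι} {f : Finset ι → Laurent L ι} {c : P.Coch}
    (hf : ∀ i ∈ t, P.IsRep (t.erase i) (f (t.erase i)) (c (t.erase i))) :
    P.IsRep t (_root_.altSum f t) (d c t) := by
  refine IsRep.altSum fun i hi => ?_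
  rw [resTo, dif_pos (Finset.erase_subset i t)]
  exact P.secRep_res (Finset.erase_subset i t) (hf i hi)

lemma IsRep.frobenius {p : ℕ} [Fact p.Prime] (hp : (Proj 𝒜).IsCharP p) {s : Finset ι}
    {f : Laurent L ι} {σ} (hf : P.IsRep s f σ) :
    P.IsRep s (f ^ p) (((((Proj 𝒜).frobeniusAbSheaf p hp).hom).app _).hom σ) :=
  (P.secRep s).pow_mem hf p

end FormPresentation

namespace Laurent

variable {L ι : Type*} [Field L] [Fintype ι] [LinearOrder ι]

lemma altSum_mem_piece {e : ℤ} {c : Finset ι → Laurent L ι} (hc : ∀ s, c s ∈ piece L s e)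
    (t : Finset ι) : altSum c t ∈ piece L t e :=
  sum_mem fun i _ => zsmul_mem (piece_mono (Finset.erase_subset i t) e (hc _)) _

lemma altSum_mul (H : Laurent L ι) (c : Finset ι → Laurent L ι) (t : Finset ι) :
    altSum (fun s => H * c s) t = H * altSum c t :=
  (map_altSum (AddMonoidHom.mulLeft H) c t).symm

lemma altSum_pow (p : ℕ) [Fact p.Prime] [CharP L p] (c : Finset ι → Laurent L ι)
    (t : Finset ι) : altSum (fun s => c s ^ p) t = altSum c t ^ p :=
  (map_altSum (frobenius (Laurent L ι) p) c t).symm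

lemma ofPoly_pow_eq_mul {p : ℕ} (hp : p.Prime) (h : MvPolynomial ι L) (t : Laurent L ι) :
    (ofPoly h * t) ^ p = ofPoly h * (ofPoly (h ^ (p - 1)) * t ^ p) := by
  obtain ⟨q, rfl⟩ : ∃ q, p = q + 1 := ⟨p - 1, by have := hp.pos; omega⟩
  rw [Nat.add_sub_cancel, map_pow]; ring

end Laurent

/-! ### Frobenius on the Čech cohomology of the hypersurface -/

namespace FormPresentation

open Laurent AltCech

variable {L ι : Type*} {A : Type u} [Field L] [Fintype ι] [LinearOrder ι] [CommRing A] [Algebra L A]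
  {𝒜 : ℕ → Submodule L A} {h : MvPolynomial ι L} {P : FormPresentation 𝒜 h} [GradedAlgebra 𝒜]

lemma exists_isRep_cochain (c : P.Coch) : ∃ r : Finset ι → Laurent L ι,
    (∀ s, r s ∈ piece L s 0) ∧ ∀ s, s.Nonempty → P.IsRep s (r s) (c s) := by
  have : ∀ s, ∃ r ∈ piece L s 0, s.Nonempty → P.IsRep s r (c s) := fun s => by
    by_cases hs : s.Nonempty
    · obtain ⟨r, hr, hr'⟩ := P.exists_mem_piece_secRep hs (c s)
      exact ⟨r, hr, fun _ => hr'⟩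
    · exact ⟨0, zero_mem _, fun h => absurd h hs⟩
  choose r hr hr' using this
  exact ⟨r, hr, hr'⟩

lemma exists_cochain_isRep {r : Finset ι → Laurent L ι} (hr : ∀ s, r s ∈ piece L s 0) :
    ∃ c : P.Coch, ∀ s, P.IsRep s (r s) (c s) := by
  choose c hc using fun s => P.exists_secRep (hr s)
  exact ⟨c, hc⟩

lemma IsRep.eq {s : Finset ι} {f : Laurent L ι} {σ τ} (hσ : P.IsRep s f σ) (hτ : P.IsRep s f τ) :
    σ = τ := P.eq_of_mem_secRep hσ hτ

variable {k d : ℕ}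

/-- The class of `t` is the image of `c` under the connecting map to `H^N(ℙ^N, 𝒪(-d))`. -/
lemma exists_altSum_univ_eq_mul (hk : Fintype.card ι = k + 1) (hk2 : 2 ≤ k)
    (hh : h.IsHomogeneous d) {c : P.Coch} (hc : IsClosed k c) {r : Finset ι → Laurent L ι}
    (hr : ∀ s, r s ∈ piece L s 0) (hrc : ∀ s, s.Nonempty → P.IsRep s (r s) (c s)) :
    ∃ t ∈ piece L Finset.univ (-d), altSum r Finset.univ = ofPoly h * t := by
  have hcard : (Finset.univ : Finset ι).card = k + 1 := Finset.card_univ.trans hk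
  refine P.exists_eq_mul_of_secRep_zero hh (Finset.card_pos.1 (by omega))
    (altSum_mem_piece hr _) ?_
  have := IsRep.d (t := Finset.univ) fun i hi => hrc (Finset.univ.erase i)
    (Finset.card_pos.1 (by rw [Finset.card_erase_of_mem hi]; omega))
  rwa [hc _ hcard] at this

/-- A Čech cochain represented by Laurent polynomials whose alternating sum is a multiple of `h`
by a Laurent polynomial without negative part is a coboundary. -/
lemma exists_eqDeg_d (hk : Fintype.card ι = k + 1) {c : P.Coch} {r : Finset ι → Laurent L ι}
    (hr : ∀ s, r s ∈ piece L s 0) (hrc : ∀ s, s.card = k → P.IsRep s (r s) (c s))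
    (hh : h.IsHomogeneous d) {t : Laurent L ι} (ht : t ∈ piece L Finset.univ (-d))
    (hneg : NegZero t) (hrt : altSum r Finset.univ = ofPoly h * t) :
    ∃ u, EqDeg k c (AltCech.d u) := by
  have : Nonempty ι := Fintype.card_pos_iff.1 (by omega)
  -- Subtracting `h w` from `r` leaves the represented sections unchanged and makes the alternating
  -- sum zero.
  obtain ⟨w, hw, rfl⟩ := exists_altSum_univ_eq ht hneg
  have hhw : ∀ s, ofPoly h * w s ∈ piece L s 0 := fun s => by
    have := mul_mem_piece (ofPoly_mem_piece hh s) (hw s)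
    rwa [add_neg_cancel] at this
  obtain ⟨u, hu, hu'⟩ := exists_altSum_eq_of_altSum_univ (c := r - fun s => ofPoly h * w s)
    (fun s => sub_mem (hr s) (hhw s)) (by
      rw [altSum_sub, Pi.sub_apply, hrt, altSum_mul, sub_self])
  obtain ⟨τ, hτ⟩ := exists_cochain_isRep (P := P) hu
  refine ⟨τ, fun s hs => ?_⟩
  have h1 := IsRep.d (t := s) fun i _ => hτ (s.erase i)
  rw [hu' s (by omega)] at h1
  have h2 : P.IsRep s (r s - ofPoly h * w s) (c s) := by
    rw [← sub_zero (c s)]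
    exact (hrc s hs).sub (P.secRep_mul_zero (hw s))
  exact h2.eq h1

variable {p : ℕ} [Fact p.Prime] [CharP L p] [PerfectField L]

/-- If `F c = d u`, then `r^p - dρ = h v`, and taking alternating sums and cancelling `h` gives
`h^(p-1) t^p = dv`. The summands of `dv` live on proper subsets of the variables, so have no
negative part; hence neither has `t`. The bound `2 ≤ k` keeps every set on which `u` is represented
nonempty. -/
theorem cechInjective_frobenius (hp : (Proj 𝒜).IsCharP p) (hk : Fintype.card ι = k + 1)
    (hk2 : 2 ≤ k) (hd : Fintype.card ι ≤ d) (hh : h.IsHomogeneous d) (h0 : h ≠ 0)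
    (hτ : Ideal.span (Set.range (MvPolynomial.X : ι → MvPolynomial ι L)) ^
      (d - Fintype.card ι) ≤ Ideal.testIdeal p (Ideal.span {h}) (1 - 1 / (p : ℝ))) :
    CechInjective (⊤ : (Proj 𝒜).Opens) P.chart ((Proj 𝒜).frobeniusAbSheaf p hp).hom k := by
  rintro c hc ⟨u, hu⟩
  have hpr : p.Prime := Fact.out
  obtain ⟨r, hr, hrc⟩ := exists_isRep_cochain c
  obtain ⟨ρ, hρ, hρu⟩ := exists_isRep_cochain u
  obtain ⟨t, ht, hrt⟩ := exists_altSum_univ_eq_mul hk hk2 hh hc hr hrc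
  have hv : ∀ s : Finset ι, ∃ v ∈ piece L s (-d), s.card = k →
      r s ^ p - altSum ρ s = ofPoly h * v := fun s => by
    by_cases hs : s.card = k
    · have hne : s.Nonempty := Finset.card_pos.1 (by omega)
      have h1 := (hrc s hne).frobenius hp
      have h2 := IsRep.d (t := s) fun i hi => hρu (s.erase i)
        (Finset.card_pos.1 (by rw [Finset.card_erase_of_mem hi]; omega))
      have h3 : P.IsRep s (r s ^ p - altSum ρ s) 0 := by
        rw [← sub_eq_zero.2 (hu s hs)]
        exact h1.sub h2
      have h4 : r s ^ p ∈ piece L s 0 := by simpa using pow_mem_piece (hr s) p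
      obtain ⟨v, hv, hv'⟩ := P.exists_eq_mul_of_secRep_zero hh hne
        (sub_mem h4 (altSum_mem_piece hρ s)) h3
      exact ⟨v, hv, fun _ => hv'⟩
    · exact ⟨0, zero_mem _, fun h => absurd h hs⟩
  choose v hv hv' using hv
  have key : ofPoly (h ^ (p - 1)) * t ^ p = altSum v Finset.univ := by
    refine mul_left_cancel₀ (a := ofPoly h) ?_ ?_
    · rw [Ne, ← map_zero (ofPoly : MvPolynomial ι L →ₐ[L] Laurent L ι)]
      exact fun h' => h0 (ofPoly_injective h')
    · rw [← ofPoly_pow_eq_mul hpr, ← hrt, ← altSum_pow, ← altSum_mul,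
        ← add_zero (altSum (fun s => ofPoly h * v s) _), ← altSum_altSum ρ Finset.univ,
        ← Pi.add_apply, ← altSum_add]
      refine altSum_congr fun i hi => ?_
      rw [Pi.add_apply, ← hv' _ (by rw [Finset.card_erase_of_mem hi, Finset.card_univ]; omega),
        sub_add_cancel]
  have hneg : NegZero t := by
    refine negZero_of_negZero_pow p hd hτ ht ?_
    rw [key]
    exact NegZero.sum fun i _ =>
      (negZero_of_mem_piece (Finset.notMem_erase i _) (hv _)).zsmul _
  exact exists_eqDeg_d hk hr (fun s hs => hrc s (Finset.card_pos.1 (by omega))) hh ht hneg hrt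

/-- Choose `t'` whose twisted Frobenius agrees with `t` up to negative-free terms, and realise it by
a cocycle `c`. The obstruction attached to `c' - F c` is then without negative part. -/
theorem cechSurjective_frobenius (hp : (Proj 𝒜).IsCharP p) (hk : Fintype.card ι = k + 1)
    (hk2 : 2 ≤ k) (hd : Fintype.card ι ≤ d) (hh : h.IsHomogeneous d)
    (hτ : Ideal.span (Set.range (MvPolynomial.X : ι → MvPolynomial ι L)) ^
      (d - Fintype.card ι) ≤ Ideal.testIdeal p (Ideal.span {h}) (1 - 1 / (p : ℝ))) :
    CechSurjective (⊤ : (Proj 𝒜).Opens) P.chart ((Proj 𝒜).frobeniusAbSheaf p hp).hom k := by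
  intro c' hc'
  have hpr : p.Prime := Fact.out
  have : Nonempty ι := Fintype.card_pos_iff.1 (by omega)
  obtain ⟨r, hr, hrc⟩ := exists_isRep_cochain c'
  obtain ⟨t, ht, hrt⟩ := exists_altSum_univ_eq_mul hk hk2 hh hc' hr hrc
  obtain ⟨t', ht', hneg⟩ := exists_negZero_sub p hd hh hτ ht
  have hht : ofPoly h * t' ∈ piece L Finset.univ 0 := by
    have := mul_mem_piece (ofPoly_mem_piece hh _) ht'
    rwa [add_neg_cancel] at this
  -- Surjectivity of the connecting map, from `H^N(ℙ^N, 𝒪) = 0`: the element `h t'` of degree zero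
  -- is a coboundary of Laurent cochains.
  obtain ⟨r', hr', hrt'⟩ := exists_altSum_univ_eq hht (negZero_of_mem_piece_zero hht)
  obtain ⟨c, hc⟩ := exists_cochain_isRep (P := P) hr'
  have hcl : IsClosed k c := fun T hT => by
    obtain rfl : T = Finset.univ := Finset.eq_univ_of_card T (by omega)
    have h1 := IsRep.d (t := Finset.univ) fun i _ => hc (Finset.univ.erase i)
    rw [hrt'] at h1
    exact h1.eq (P.secRep_mul_zero ht')
  refine ⟨c, hcl, ?_⟩
  have hmem : t - ofPoly (h ^ (p - 1)) * t' ^ p ∈ piece L Finset.univ (-d) := by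
    have h1 := mul_mem_piece (ofPoly_mem_piece (hh.pow (p - 1)) Finset.univ) (pow_mem_piece ht' p)
    rw [show ((d * (p - 1) : ℕ) : ℤ) + p * -(d : ℤ) = -d by
      rw [Nat.cast_mul, Nat.cast_sub hpr.one_le]; push_cast; ring] at h1
    exact sub_mem ht h1
  obtain ⟨u, hu⟩ := exists_eqDeg_d (P := P) hk
    (c := c' - map ((Proj 𝒜).frobeniusAbSheaf p hp).hom c) (r := r - fun s => r' s ^ p)
    (fun s => sub_mem (hr s) (by simpa using pow_mem_piece (hr' s) p))
    (fun s hs => (hrc s (Finset.card_pos.1 (by omega))).sub ((hc s).frobenius hp)) hh hmem hneg (by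
      rw [altSum_sub, Pi.sub_apply, altSum_pow, hrt, hrt', ofPoly_pow_eq_mul hpr, mul_sub])
  exact ⟨u, fun s hs => by rw [Pi.add_apply, ← hu s hs]; simp⟩

end FormPresentation

/-! ### The hypersurface `V(h)` -/

namespace ProjHypersurface

variable {L : Type u} [Field L] {N : ℕ}

/-- The presentation of the homogeneous coordinate ring of a hypersurface. -/
noncomputable def presentation (h : MvPolynomial (Fin (N + 1)) L) :
    FormPresentation (grading h) h where
  π := Ideal.Quotient.mk _
  map_mem hg := ⟨_, hg, rfl⟩
  exists_map_eq := by
    rintro n _ ⟨g, hg, rfl⟩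
    exact ⟨g, hg, rfl⟩
  map_eq_zero_iff g := by rw [Ideal.Quotient.eq_zero_iff_mem, Ideal.mem_span_singleton]

end ProjHypersurface

/-- A polynomial whose test ideal contains a power of the maximal ideal is nonzero. -/
lemma ne_zero_of_pow_le_testIdeal {L : Type*} [Field L] (p : ℕ) [Fact p.Prime] [CharP L p] {N m : ℕ}
    {h : MvPolynomial (Fin (N + 1)) L}
    (hτ : Ideal.span (Set.range (MvPolynomial.X : Fin (N + 1) → MvPolynomial (Fin (N + 1)) L)) ^ m ≤
      Ideal.testIdeal p (Ideal.span {h}) (1 - 1 / (p : ℝ))) : h ≠ 0 := by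
  rintro rfl
  have hpr : p.Prime := Fact.out
  -- For `h = 0` the bound applies with `J = ⊥`, since `p - 1 > 0`; but `x_0 ^ m ≠ 0`.
  have h1 := hτ.trans (Ideal.testIdeal_one_sub_inv_le p (J := ⊥) (by
    rw [zero_pow (by have := hpr.two_le; omega)]; exact zero_mem _))
  have h2 := h1 (Ideal.pow_mem_pow (Ideal.subset_span (Set.mem_range_self 0)) m)
  rw [Ideal.mem_bot] at h2
  exact pow_ne_zero m (MvPolynomial.X_ne_zero 0) h2

theorem proposition2p3 {L : Type u} [Field L] [PerfectField L] (p : ℕ) [Fact p.Prime] [CharP L p]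
    (N d : ℕ) (hN : 2 ≤ N) (hd : N + 1 ≤ d)
    (h : MvPolynomial (Fin (N + 1)) L) (hh : h.IsHomogeneous d)
    (hτ : Ideal.span (Set.range (MvPolynomial.X : Fin (N + 1) → MvPolynomial (Fin (N + 1)) L)) ^
        (d - N - 1) ≤
      Ideal.testIdeal p (Ideal.span {h}) (1 - 1 / (p : ℝ))) :
    Function.Bijective
      ((ProjHypersurface.hypersurface hh).frobeniusAction p
        (ProjHypersurface.hypersurface_isCharP hh p) (N - 1)) := by
  have h0 : h ≠ 0 := ne_zero_of_pow_le_testIdeal p hτ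
  let := ProjHypersurface.gradedAlgebra hh
  let P := ProjHypersurface.presentation h
  have hcard : Fintype.card (Fin (N + 1)) = N + 1 := Fintype.card_fin _
  have hτ' : Ideal.span (Set.range
      (MvPolynomial.X : Fin (N + 1) → MvPolynomial (Fin (N + 1)) L)) ^
      (d - Fintype.card (Fin (N + 1))) ≤
        Ideal.testIdeal p (Ideal.span {h}) (1 - 1 / (p : ℝ)) := by
    rwa [hcard, ← Nat.sub_sub]
  -- Then `H^(N-1)` is `H^(n+1)`, computed by cochains on sets of `n + 2 = N` of the `N + 1` charts.
  obtain ⟨n, rfl⟩ : ∃ n, N = n + 2 := ⟨N - 2, by omega⟩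
  have hp : (Proj (ProjHypersurface.grading h)).IsCharP p :=
    ProjHypersurface.hypersurface_isCharP hh p
  exact AltCech.bijective_H_map P.iSup_chart (fun s hs => P.isAffineOpen_inter_chart hs) n
    ((Proj (ProjHypersurface.grading h)).frobeniusAbSheaf p hp)
    (AltCech.affineExact_structureAbSheaf _) (AltCech.affineExact_structureAbSheaf _)
    (FormPresentation.cechInjective_frobenius hp hcard hN (by omega) hh h0 hτ')
    (FormPresentation.cechSurjective_frobenius hp hcard hN (by omega) hh hτ')
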